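/- Let $\mathcal H$ be a complex Hilbert space of finite dimension $n+1\ge 1$ and let $\hbar>0$. Let $\mathcal S=\{\psi\in\mathcal H:\langle\psi|\psi\rangle=1\}\cong S^{2n+1}$ be the unit sphere and let $\mathcal P_{\mathcal H}=\mathcal S/\!\sim\;\cong\mathbb CP^n$ be the projective space (the quantum phase space), as a smooth real manifold, with $\pi:\mathcal S\to\mathcal P_{\mathcal H}$, $\psi\mapsto[\psi]$. Let $\mathcal O$ be the real vector space of observables (the self-adjoint elements of the $C^*$-algebra of operators on $\mathcal H$) and let $\mathfrak u=\mathfrak u(\mathcal H)\cong\mathfrak u(n+1)$ be the Lie algebra of the unitary group $U(\mathcal H)$, i.e. the skew-adjoint operators with the commutator bracket. For $A\in\mathcal O$ let $\hat A(\xi)=\xi(iA)$ be the corresponding linear function on the dual $\mathfrak u^*$. Let $m:\mathcal P_{\mathcal H}\to\mathfrak u^*$ be the momentum map $[\psi]\mapsto|\psi\rangle\langle\psi|/\langle\psi|\psi\rangle$, i.e. $\hat A(m([\psi]))=\langle\psi|A\psi\rangle/\langle\psi|\psi\rangle$. A Hamiltonian $H\in\mathcal O$ generates the element $\sigma_H=\frac{i}{\hbar}H\in\mathfrak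 u$, regarded as a constant section of the trivial bundle $M\times\mathfrak u\to M$ over any manifold $M$. A Lie algebroid is a smooth vector bundle $E\to M$ with a Lie bracket $[\![\cdot,\cdot]\!]$ on its smooth sections and a smooth bundle map $\rho:E\to TM$ (the anchor) such that $\rho[\![\sigma,\tau]\!]=[\rho\sigma,\rho\tau]$ and $[\![\sigma,f\tau]\!]=f[\![\sigma,\tau]\!]+(\rho(\sigma)f)\,\tau$ for all smooth sections $\sigma,\tau$ and all smooth functions $f$ on $M$. For a manifold $M$ with a smooth map $J:M\to\mathfrak u^*$, we say that a fibrewise linear map $\rho:M\times\mathfrak u\to TM$ over $M$ is given by the Heisenberg equation $i\hbar\,\dot A=AH-HA$ if $$d(\hat A\circ J)\bigl(\rho(\sigma_H)\bigr)=\hat B\circ J,\qquad B=\tfrac1{i\hbar}(AH-HA),\qquad\text{for all }H,A\in\mathcal O ,$$ and for such a $\rho$ we define a bracket on the sections $\sigma,\tau:M\to\mathfrak u$ by $[\![\sigma,\tau]\!]=[\sigma,\tau]+\rho(\sigma)\tau-\rho(\tau)\sigma$, which extends the bracket of $\mathfrak u$ from constant sections. Then: 1. $\pi:\mathcal S\to\mathcal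 P_{\mathcal H}$ is a smooth principal bundle whose structure group is the group $U(1)$ of phases, and $\pi^{-1}([\psi])=\{e^{i\theta}\psi/\|\psi\|:\theta\in\mathbb R\}$ for every $\psi\ne0$. The map $m$ is smooth and injective, and its image is a single orbit of the coadjoint action of $U(\mathcal H)$ on $\mathfrak u^*$. 2. The map $H\mapsto\sigma_H$ is a bijection $\mathcal O\to\mathfrak u$, and $[\sigma_H,\sigma_K]=\sigma_L$ with $L=\frac1{i\hbar}(KH-HK)=\frac i\hbar(HK-KH)$. The Lie–Poisson bracket $\{f,g\}(\xi)=\xi([df_\xi,dg_\xi])$ is a Poisson bracket on $C^\infty(\mathfrak u^*)$, and $\frac1\hbar\{\hat H,\hat A\}=\hat B$ with $B=\frac1{i\hbar}(AH-HA)$. 3. For $M=\mathfrak u^*$ and $J=\mathrm{id}$, exactly one $\rho$ is given by the Heisenberg equation. With this anchor and the bracket above, $\mathfrak u^*\times\mathfrak u\to\mathfrak u^*$ is a Lie algebroid, and $\rho(\sigma_H)$ is the Hamiltonian vector field $\frac1\hbar\{\hat H,\cdot\}$. 4. For $M=\mathcal P_{\mathcal H}$ and $J=m$, exactly one $\rho$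 is given by the Heisenberg equation. With this anchor and the bracket above, $\mathcal P_{\mathcal H}\times\mathfrak u\to\mathcal P_{\mathcal H}$ is a Lie algebroid. -/

import Mathlib

open scoped Manifold ContDiff LinearAlgebra.Projectivization InnerProductSpace
open Bundle

noncomputable section

/-! ### Lie algebroids -/

section LieAlgebroid

variable {E₀ : Type*} [NormedAddCommGroup E₀] [NormedSpace ℝ E₀]
  {H₀ : Type*} [TopologicalSpace H₀] (I : ModelWithCorners ℝ E₀ H₀)
  {M : Type*} [TopologicalSpace M] [ChartedSpace H₀ M]

/-- The derivative `v(f) = df_x(v)` of a function `f : M → F` with values in a normed space along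
a tangent vector `v` at `x`. -/
def derivAlong {F : Type*} [NormedAddCommGroup F] [NormedSpace ℝ F] (f : M → F) (x : M)
    (v : TangentSpace I x) : F :=
  mfderiv I 𝓘(ℝ, F) f x v

variable [IsManifold I ∞ M]
  (F : Type*) [NormedAddCommGroup F] [NormedSpace ℝ F]
  (E : M → Type*) [TopologicalSpace (TotalSpace F E)]
  [∀ x, AddCommGroup (E x)] [∀ x, Module ℝ (E x)] [∀ x, TopologicalSpace (E x)]
  [FiberBundle F E] [VectorBundle ℝ F E]

/-- `σ` is a (global) smooth section of the vector bundle `E → M` with typical fibre `F`. -/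
def IsSmoothSection (σ : ∀ x, E x) : Prop :=
  ContMDiff I (I.prod 𝓘(ℝ, F)) ∞ (fun x => TotalSpace.mk' F x (σ x))

/-- A smooth real vector bundle `E → M`, a bracket on its smooth sections and a bundle map
`anchor : E → TM` form a Lie algebroid. -/
structure IsLieAlgebroid (bracket : (∀ x, E x) → (∀ x, E x) → ∀ x, E x)
    (anchor : ∀ x, E x →L[ℝ] TangentSpace I x) : Prop where
  smooth_bundle : ContMDiffVectorBundle ∞ F E I
  /-- the anchor is a smooth map of total spaces -/
  smooth_anchor : ContMDiff (I.prod 𝓘(ℝ, F)) I.tangent ∞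
    (fun v : TotalSpace F E => (⟨v.1, anchor v.1 v.2⟩ : TangentBundle I M))
  smooth_bracket : ∀ σ τ, IsSmoothSection I F E σ → IsSmoothSection I F E τ →
    IsSmoothSection I F E (bracket σ τ)
  bracket_add : ∀ σ τ υ, IsSmoothSection I F E σ → IsSmoothSection I F E τ →
    IsSmoothSection I F E υ → bracket σ (τ + υ) = bracket σ τ + bracket σ υ
  bracket_smul : ∀ (c : ℝ) σ τ, IsSmoothSection I F E σ → IsSmoothSection I F E τ →
    bracket σ (c • τ) = c • bracket σ τ
  bracket_skew : ∀ σ τ, IsSmoothSection I F E σ → IsSmoothSection I F E τ →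
    bracket σ τ = - bracket τ σ
  jacobi : ∀ σ τ υ, IsSmoothSection I F E σ → IsSmoothSection I F E τ →
    IsSmoothSection I F E υ →
    bracket σ (bracket τ υ) + bracket τ (bracket υ σ) + bracket υ (bracket σ τ) = 0
  /-- the Leibniz rule `⟦σ, f τ⟧ = f ⟦σ, τ⟧ + (ρ(σ) f) τ` -/
  leibniz : ∀ (f : M → ℝ) σ τ, ContMDiff I 𝓘(ℝ, ℝ) ∞ f →
    IsSmoothSection I F E σ → IsSmoothSection I F E τ → ∀ x,
    bracket σ (fun y => f y • τ y) x =
      f x • bracket σ τ x + derivAlong I f x (anchor x (σ x)) • τ x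
  /-- `ρ⟦σ, τ⟧ = [ρ(σ), ρ(τ)]`, the bracket on the right being that of vector fields -/
  anchor_bracket : ∀ σ τ, IsSmoothSection I F E σ → IsSmoothSection I F E τ → ∀ x,
    anchor x (bracket σ τ x) =
      VectorField.mlieBracket I (fun y => anchor y (σ y)) (fun y => anchor y (τ y)) x

end LieAlgebroid

/-! ### Poisson brackets and principal bundles -/

/-- `B` is a Poisson bracket on the algebra of smooth real functions of a manifold. -/
structure IsPoissonBracket {E₀ : Type*} [NormedAddCommGroup E₀] [NormedSpace ℝ E₀]
    {H₀ : Type*} [TopologicalSpace H₀] (I : ModelWithCorners ℝ E₀ H₀)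
    {M : Type*} [TopologicalSpace M] [ChartedSpace H₀ M]
    (B : (M → ℝ) → (M → ℝ) → M → ℝ) : Prop where
  smooth : ∀ f g, ContMDiff I 𝓘(ℝ, ℝ) ∞ f → ContMDiff I 𝓘(ℝ, ℝ) ∞ g →
    ContMDiff I 𝓘(ℝ, ℝ) ∞ (B f g)
  add_left : ∀ f g h, ContMDiff I 𝓘(ℝ, ℝ) ∞ f → ContMDiff I 𝓘(ℝ, ℝ) ∞ g →
    ContMDiff I 𝓘(ℝ, ℝ) ∞ h → B (f + g) h = B f h + B g h
  smul_left : ∀ (c : ℝ) f g, ContMDiff I 𝓘(ℝ, ℝ) ∞ f → ContMDiff I 𝓘(ℝ, ℝ) ∞ g →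
    B (c • f) g = c • B f g
  skew : ∀ f g, ContMDiff I 𝓘(ℝ, ℝ) ∞ f → ContMDiff I 𝓘(ℝ, ℝ) ∞ g → B f g = - B g f
  leibniz : ∀ f g h, ContMDiff I 𝓘(ℝ, ℝ) ∞ f → ContMDiff I 𝓘(ℝ, ℝ) ∞ g →
    ContMDiff I 𝓘(ℝ, ℝ) ∞ h → B (f * g) h = f * B g h + g * B f h
  jacobi : ∀ f g h, ContMDiff I 𝓘(ℝ, ℝ) ∞ f → ContMDiff I 𝓘(ℝ, ℝ) ∞ g →
    ContMDiff I 𝓘(ℝ, ℝ) ∞ h → B f (B g h) + B g (B h f) + B h (B f g) = 0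

/-- `proj : P → M` is a smooth principal `G`-bundle (the action of `G` on `P` is written on the
left). -/
structure IsPrincipalBundle
    {E₁ : Type*} [NormedAddCommGroup E₁] [NormedSpace ℝ E₁] {H₁ : Type*} [TopologicalSpace H₁]
    (IG : ModelWithCorners ℝ E₁ H₁)
    {E₂ : Type*} [NormedAddCommGroup E₂] [NormedSpace ℝ E₂] {H₂ : Type*} [TopologicalSpace H₂]
    (IP : ModelWithCorners ℝ E₂ H₂)
    {E₃ : Type*} [NormedAddCommGroup E₃] [NormedSpace ℝ E₃] {H₃ : Type*} [TopologicalSpace H₃]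
    (IM : ModelWithCorners ℝ E₃ H₃)
    (G : Type*) [TopologicalSpace G] [ChartedSpace H₁ G] [Group G] [LieGroup IG ∞ G]
    {P : Type*} [TopologicalSpace P] [ChartedSpace H₂ P] [MulAction G P]
    {M : Type*} [TopologicalSpace M] [ChartedSpace H₃ M] (proj : P → M) : Prop where
  smooth_action : ContMDiff (IG.prod IP) IP ∞ (fun x : G × P => x.1 • x.2)
  smooth_proj : ContMDiff IP IM ∞ proj
  surjective_proj : Function.Surjective proj
  proj_smul : ∀ (g : G) (p : P), proj (g • p) = proj p
  /-- `G`-equivariant smooth local trivialisations `proj⁻¹(U) ≅ U × G` over `U` -/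
  locally_trivial : ∀ x : M, ∃ (U : Set M) (e : OpenPartialHomeomorph P (M × G)),
    IsOpen U ∧ x ∈ U ∧ e.source = proj ⁻¹' U ∧ e.target = U ×ˢ Set.univ ∧
    ContMDiffOn IP (IM.prod IG) ∞ e e.source ∧
    ContMDiffOn (IM.prod IG) IP ∞ e.symm e.target ∧
    ∀ p ∈ e.source, (e p).1 = proj p ∧ ∀ g : G, (e (g • p)).2 = g * (e p).2

/-! ### The Lie algebra `𝔲(V)` of the unitary group, and observables -/

section Unitary

variable (V : Type*) [NormedAddCommGroup V] [InnerProductSpace ℂ V] [CompleteSpace V]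

/-- The skew-adjoint operators on the Hilbert space `V`: the Lie algebra `𝔲(V)` of its unitary
group. -/
abbrev UnitaryLie : Type _ := skewAdjoint.submodule ℝ (V →L[ℂ] V)

/-- The dual `𝔲(V)*`. -/
abbrev UnitaryDual : Type _ := StrongDual ℝ (UnitaryLie V)

/-- The observables: self-adjoint operators on `V`. -/
abbrev Observable : Type _ := selfAdjoint (V →L[ℂ] V)

variable {V}

/-- The bracket of `𝔲(V)` is the commutator. -/
instance UnitaryLie.instBracket : Bracket (UnitaryLie V) (UnitaryLie V) where
  bracket ξ η := ⟨ξ.1 * η.1 - η.1 * ξ.1, by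
    have hξ : star ξ.1 = -ξ.1 := ξ.2
    have hη : star η.1 = -η.1 := η.2
    change star (ξ.1 * η.1 - η.1 * ξ.1) = -(ξ.1 * η.1 - η.1 * ξ.1)
    simp [star_sub, star_mul, hξ, hη]⟩

instance UnitaryLie.instLieRing : LieRing (UnitaryLie V) where
  add_lie x y z := Subtype.ext <| by
    change (x.1 + y.1) * z.1 - z.1 * (x.1 + y.1) =
      (x.1 * z.1 - z.1 * x.1) + (y.1 * z.1 - z.1 * y.1)
    noncomm_ring
  lie_add x y z := Subtype.ext <| by
    change x.1 * (y.1 + z.1) - (y.1 + z.1) * x.1 =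
      (x.1 * y.1 - y.1 * x.1) + (x.1 * z.1 - z.1 * x.1)
    noncomm_ring
  lie_self x := Subtype.ext <| sub_self _
  leibniz_lie x y z := Subtype.ext <| by
    change x.1 * (y.1 * z.1 - z.1 * y.1) - (y.1 * z.1 - z.1 * y.1) * x.1 =
      ((x.1 * y.1 - y.1 * x.1) * z.1 - z.1 * (x.1 * y.1 - y.1 * x.1)) +
      (y.1 * (x.1 * z.1 - z.1 * x.1) - (x.1 * z.1 - z.1 * x.1) * y.1)
    noncomm_ring

instance UnitaryLie.instLieAlgebra : LieAlgebra ℝ (UnitaryLie V) where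
  lie_smul t x y := Subtype.ext <| by
    change x.1 * (t • y.1) - (t • y.1) * x.1 = t • (x.1 * y.1 - y.1 * x.1)
    rw [mul_smul_comm, smul_mul_assoc, smul_sub]

/-- The skew-adjoint operator `iA` associated with an observable `A`. -/
def observableToLie (A : Observable V) : UnitaryLie V :=
  ⟨Complex.I • A.1, by
    have hA : star A.1 = A.1 := A.2
    change star (Complex.I • A.1) = -(Complex.I • A.1)
    simp [star_smul, hA]⟩

/-- The linear function `Â(ζ) = ζ(iA)` on `𝔲(V)*` associated with an observable `A`. -/
def observableHat (A : Observable V) (ζ : UnitaryDual V) : ℝ := ζ (observableToLie A)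

/-- The element `(i/ħ) H` of `𝔲(V)` generated by the Hamiltonian `H`. -/
def hamiltonianElement (ħ : ℝ) (H : Observable V) : UnitaryLie V := ħ⁻¹ • observableToLie H

/-- The right-hand side `(iħ)⁻¹ (A H - H A)` of the Heisenberg equation `iħ Ȧ = A H - H A`. -/
def heisenbergRHS (ħ : ℝ) (H A : Observable V) : Observable V :=
  ⟨(Complex.I * (ħ : ℂ))⁻¹ • (A.1 * H.1 - H.1 * A.1), by
    have hA : star A.1 = A.1 := A.2
    have hH : star H.1 = H.1 := H.2
    change star _ = _
    simp [star_smul, hA, hH, mul_comm, ← smul_neg]⟩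

/-- Let `J : M → 𝔲(V)*`, so that each observable `A` gives a function `Â ∘ J` on `M`. An anchor
`ρ : M × 𝔲(V) → TM` is given by the Heisenberg equation if, along the vector field defined by `ρ`
and the (constant) section of a Hamiltonian `H`, all observables evolve by `iħ Ȧ = A H - H A`. -/
def IsHeisenbergAnchor {E₀ : Type*} [NormedAddCommGroup E₀] [NormedSpace ℝ E₀]
    {H₀ : Type*} [TopologicalSpace H₀] (I : ModelWithCorners ℝ E₀ H₀)
    {M : Type*} [TopologicalSpace M] [ChartedSpace H₀ M] (ħ : ℝ) (J : M → UnitaryDual V)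
    (ρ : ∀ x : M, Trivial M (UnitaryLie V) x →L[ℝ] TangentSpace I x) : Prop :=
  ∀ (H A : Observable V) (x : M),
    derivAlong I (fun y => observableHat A (J y)) x (ρ x (hamiltonianElement ħ H)) =
      observableHat (heisenbergRHS ħ H A) (J x)

/-- The bracket on the sections of `M × 𝔲(V)` (functions `M → 𝔲(V)`) that extends the bracket of
`𝔲(V)` (constant sections) by the Leibniz rule: `⟦σ, τ⟧ = [σ, τ] + ρ(σ)τ - ρ(τ)σ`. -/
def sectionBracket {E₀ : Type*} [NormedAddCommGroup E₀] [NormedSpace ℝ E₀]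
    {H₀ : Type*} [TopologicalSpace H₀] (I : ModelWithCorners ℝ E₀ H₀)
    {M : Type*} [TopologicalSpace M] [ChartedSpace H₀ M]
    (ρ : ∀ x : M, Trivial M (UnitaryLie V) x →L[ℝ] TangentSpace I x)
    (σ τ : M → UnitaryLie V) : M → UnitaryLie V := fun x =>
  ⁅σ x, τ x⁆ + derivAlong I τ x (ρ x (σ x)) - derivAlong I σ x (ρ x (τ x))

/-- The adjoint action `Ad_U ξ = U ξ U†` of the unitary group on `𝔲(V)`. -/
def unitaryAd (U : unitary (V →L[ℂ] V)) (ξ : UnitaryLie V) : UnitaryLie V :=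
  ⟨U.1 * ξ.1 * star U.1, by
    have hξ : star ξ.1 = -ξ.1 := ξ.2
    change star _ = -_
    simp [hξ, mul_assoc]⟩

/-- The orbit of `ζ` under the coadjoint action `(Ad*_U ζ)(ξ) = ζ(Ad_{U⁻¹} ξ)`. -/
def coadjointOrbit (ζ : UnitaryDual V) : Set (UnitaryDual V) :=
  {η | ∃ U : unitary (V →L[ℂ] V), ∀ ξ, η ξ = ζ (unitaryAd U⁻¹ ξ)}

variable [FiniteDimensional ℂ V]

/-- The differential at `ζ` of a function `f` on `𝔲(V)*`, as an element of `𝔲(V) ≅ 𝔲(V)**`. -/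
def dualGradient (f : UnitaryDual V → ℝ) (ζ : UnitaryDual V) : UnitaryLie V :=
  (Module.evalEquiv ℝ (UnitaryLie V)).symm
    ((fderiv ℝ f ζ).toLinearMap ∘ₗ
      (LinearMap.toContinuousLinearMap :
        (UnitaryLie V →ₗ[ℝ] ℝ) ≃ₗ[ℝ] UnitaryDual V).toLinearMap)

/-- The Lie-Poisson bracket `{f, g}(ζ) = ζ([df_ζ, dg_ζ])` on `𝔲(V)*`. -/
def liePoisson (f g : UnitaryDual V → ℝ) (ζ : UnitaryDual V) : ℝ :=
  ζ ⁅dualGradient f ζ, dualGradient g ζ⁆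

/-- The defining property of `dualGradient`. -/
theorem apply_dualGradient (f : UnitaryDual V → ℝ) (ζ η : UnitaryDual V) :
    η (dualGradient f ζ) = fderiv ℝ f ζ η := by
  have h := LinearMap.congr_fun ((Module.evalEquiv ℝ (UnitaryLie V)).apply_symm_apply
    ((fderiv ℝ f ζ).toLinearMap ∘ₗ
      (LinearMap.toContinuousLinearMap :
        (UnitaryLie V →ₗ[ℝ] ℝ) ≃ₗ[ℝ] UnitaryDual V).toLinearMap)) η.toLinearMap
  exact h

end Unitary

/-! ### Pure states: the unit sphere and the projective space -/

section PureStates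

open Metric

variable {V : Type*} [NormedAddCommGroup V] [InnerProductSpace ℂ V]

/-- The projective space carries the quotient topology. -/
instance Projectivization.instTopologicalSpaceComplex : TopologicalSpace (ℙ ℂ V) :=
  inferInstanceAs (TopologicalSpace (Quotient (projectivizationSetoid ℂ V)))

/-- The group `U(1)` of phases acts on the unit sphere `S` of `V`. -/
instance Circle.instMulActionSphere : MulAction Circle (sphere (0 : V) 1) where
  smul c ψ := ⟨(c : ℂ) • ψ.1, by simp [norm_smul, Circle.norm_coe]⟩
  one_smul ψ := Subtype.ext (one_smul ℂ ψ.1)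
  mul_smul c d ψ := Subtype.ext (mul_smul (c : ℂ) (d : ℂ) ψ.1)

/-- The projection `ψ ↦ [ψ]` from the unit sphere onto the projective space. -/
def sphereProj (ψ : sphere (0 : V) 1) : ℙ ℂ V :=
  Projectivization.mk ℂ ψ.1 (ne_zero_of_mem_unit_sphere ψ)

section

variable {n : ℕ} [hn : Fact (Module.finrank ℂ V = n + 1)]

instance finrank_real_fact : Fact (Module.finrank ℝ V = (2 * n + 1) + 1) :=
  ⟨by rw [finrank_real_of_complex, hn.out]; ring⟩

/-- The unit sphere is a manifold of dimension `2n + 1`: it is the unit sphere of the real Euclidean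
space underlying `V`. -/
instance instChartedSpaceStateSphere :
    ChartedSpace (EuclideanSpace ℝ (Fin (2 * n + 1))) (sphere (0 : V) 1) :=
  letI : InnerProductSpace ℝ V := InnerProductSpace.complexToReal
  EuclideanSpace.instChartedSpaceSphere

instance instIsManifoldStateSphere : IsManifold (𝓡 (2 * n + 1)) ∞ (sphere (0 : V) 1) :=
  letI : InnerProductSpace ℝ V := InnerProductSpace.complexToReal
  haveI : IsManifold (𝓡 (2 * n + 1)) ω (sphere (0 : V) 1) :=
    EuclideanSpace.instIsManifoldSphere
  inferInstance

variable (V n) in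
/-- The coordinates of `V` in a fixed orthonormal basis. -/
def stateCoord : V ≃L[ℂ] EuclideanSpace ℂ (Fin (n + 1)) :=
  haveI : FiniteDimensional ℂ V := Module.finite_of_finrank_eq_succ hn.out
  ((stdOrthonormalBasis ℂ V).reindex (finCongr hn.out)).repr.toContinuousLinearEquiv

variable (V) in
/-- The vector `ψ` with homogeneous coordinates `ψ_i = 1` and `z` in the other places. -/
def affineVec (i : Fin (n + 1)) (z : EuclideanSpace ℂ (Fin n)) : V :=
  (stateCoord V n).symm (WithLp.toLp 2 (i.insertNth (1 : ℂ) z))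

theorem stateCoord_affineVec (i : Fin (n + 1)) (z : EuclideanSpace ℂ (Fin n)) :
    stateCoord V n (affineVec V i z) = WithLp.toLp 2 (i.insertNth (1 : ℂ) z) := by
  simp [affineVec]

theorem affineVec_ne_zero (i : Fin (n + 1)) (z : EuclideanSpace ℂ (Fin n)) :
    affineVec V i z ≠ 0 := by
  intro h
  have h1 := stateCoord_affineVec (V := V) i z
  rw [h, map_zero] at h1
  have h2 := congrArg (fun w : EuclideanSpace ℂ (Fin (n + 1)) => w i) h1
  simp at h2

/-- The affine coordinates `(ψ_j / ψ_i)_{j ≠ i}`. -/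
def affineCoord (i : Fin (n + 1)) (v : V) : EuclideanSpace ℂ (Fin n) :=
  WithLp.toLp 2 (fun j => stateCoord V n v (i.succAbove j) / stateCoord V n v i)

theorem affineCoord_smul (i : Fin (n + 1)) {c : ℂ} (hc : c ≠ 0) (v : V) :
    affineCoord i (c • v) = affineCoord i v := by
  simp [affineCoord, mul_div_mul_left _ _ hc]

theorem affineCoord_affineVec (i : Fin (n + 1)) (z : EuclideanSpace ℂ (Fin n)) :
    affineCoord i (affineVec V i z) = z := by
  ext j
  simp [affineCoord, stateCoord_affineVec]

theorem smul_affineVec_affineCoord (i : Fin (n + 1)) (v : V) (hv : stateCoord V n v i ≠ 0) :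
    stateCoord V n v i • affineVec V i (affineCoord i v) = v := by
  apply (stateCoord V n).injective
  rw [map_smul, stateCoord_affineVec]
  ext j
  refine Fin.succAboveCases i ?_ (fun k => ?_) j
  · simp
  · simp [affineCoord, mul_div_cancel₀ _ hv]

theorem rep_mk_coord (v : V) (hv : v ≠ 0) :
    ∃ c : ℂ, c ≠ 0 ∧ (Projectivization.mk ℂ v hv).rep = c • v := by
  obtain ⟨a, ha⟩ := Projectivization.exists_smul_eq_mk_rep ℂ v hv
  exact ⟨a, a.ne_zero, ha.symm⟩

theorem differentiable_affineVec (i : Fin (n + 1)) :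
    ContDiff ℂ ∞ (affineVec V (n := n) i) := by
  unfold affineVec
  refine (stateCoord V n).symm.contDiff.comp ?_
  rw [contDiff_euclidean]
  intro j
  refine Fin.succAboveCases i ?_ (fun k => ?_) j
  · simpa using contDiff_const
  · simpa using (EuclideanSpace.proj (𝕜 := ℂ) k).contDiff

theorem contDiffOn_affineCoord (i : Fin (n + 1)) :
    ContDiffOn ℂ ∞ (affineCoord (n := n) i) {v : V | stateCoord V n v i ≠ 0} := by
  rw [contDiffOn_euclidean]
  intro j
  have h : ∀ k, ContDiff ℂ ∞ (fun v : V => stateCoord V n v k) := fun k =>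
    (EuclideanSpace.proj (𝕜 := ℂ) k).contDiff.comp (stateCoord V n).contDiff
  exact (h _).contDiffOn.div (h _).contDiffOn (fun v hv => hv)

theorem affineCoord_rep_mk (i : Fin (n + 1)) (v : V) (hv : v ≠ 0) :
    affineCoord i (Projectivization.mk ℂ v hv).rep = affineCoord (n := n) i v := by
  obtain ⟨c, hc, h⟩ := rep_mk_coord v hv
  rw [h, affineCoord_smul i hc]

theorem stateCoord_rep_mk (i : Fin (n + 1)) (v : V) (hv : v ≠ 0) :
    stateCoord V n (Projectivization.mk ℂ v hv).rep i ≠ 0 ↔ stateCoord V n v i ≠ 0 := by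
  obtain ⟨c, hc, h⟩ := rep_mk_coord v hv
  rw [h, map_smul]
  simp [hc]

theorem isQuotientMap_mk' : Topology.IsQuotientMap (Projectivization.mk' ℂ (V := V)) :=
  isQuotientMap_quot_mk

theorem continuous_stateCoord (i : Fin (n + 1)) : Continuous (fun v : V => stateCoord V n v i) :=
  (EuclideanSpace.proj (𝕜 := ℂ) i).continuous.comp (stateCoord V n).continuous

theorem isOpen_affineSource (i : Fin (n + 1)) :
    IsOpen {p : ℙ ℂ V | stateCoord V n p.rep i ≠ 0} := by
  rw [← isQuotientMap_mk'.isOpen_preimage]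
  have h : Projectivization.mk' ℂ ⁻¹' {p : ℙ ℂ V | stateCoord V n p.rep i ≠ 0} =
      {v : {v : V // v ≠ 0} | stateCoord V n v.1 i ≠ 0} := by
    ext v
    exact stateCoord_rep_mk i v.1 v.2
  rw [h]
  exact isOpen_ne.preimage ((continuous_stateCoord i).comp continuous_subtype_val)

variable (V) in
/-- The `i`-th standard affine chart `[ψ] ↦ (ψ_j / ψ_i)_{j ≠ i}` of the projective space. -/
def affineChart (i : Fin (n + 1)) :
    OpenPartialHomeomorph (ℙ ℂ V) (EuclideanSpace ℂ (Fin n)) where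
  toFun p := affineCoord i p.rep
  invFun z := Projectivization.mk ℂ (affineVec V i z) (affineVec_ne_zero i z)
  source := {p | stateCoord V n p.rep i ≠ 0}
  target := Set.univ
  map_source' _ _ := Set.mem_univ _
  map_target' z _ := by
    change stateCoord V n _ i ≠ 0
    rw [stateCoord_rep_mk, stateCoord_affineVec]
    simp
  left_inv' p hp := by
    conv_rhs => rw [← p.mk_rep]
    rw [Projectivization.mk_eq_mk_iff']
    refine ⟨(stateCoord V n p.rep i)⁻¹, ?_⟩
    have h : (stateCoord V n p.rep i)⁻¹ • (stateCoord V n p.rep i • affineVec V i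
        (affineCoord i p.rep)) = affineVec V i (affineCoord i p.rep) :=
      inv_smul_smul₀ (show stateCoord V n p.rep i ≠ 0 from hp) _
    rwa [smul_affineVec_affineCoord i p.rep hp] at h
  right_inv' z _ := by
    rw [affineCoord_rep_mk, affineCoord_affineVec]
  open_source := isOpen_affineSource i
  open_target := isOpen_univ
  continuousOn_toFun := by
    rw [isQuotientMap_mk'.continuousOn_isOpen_iff (isOpen_affineSource i)]
    have h : (fun p : ℙ ℂ V => affineCoord (n := n) i p.rep) ∘ Projectivization.mk' ℂ =
        fun v : {v : V // v ≠ 0} => affineCoord i v.1 := by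
      funext v
      exact affineCoord_rep_mk i v.1 v.2
    rw [h]
    refine (contDiffOn_affineCoord i).continuousOn.comp continuous_subtype_val.continuousOn ?_
    intro v hv
    exact (stateCoord_rep_mk i v.1 v.2).1 hv
  continuousOn_invFun := by
    refine Continuous.continuousOn ?_
    exact isQuotientMap_mk'.continuous.comp
      ((differentiable_affineVec i).continuous.subtype_mk fun z => affineVec_ne_zero i z)

theorem exists_mem_affineChart (p : ℙ ℂ V) : ∃ i : Fin (n + 1), p ∈ (affineChart V i).source := by
  by_contra! h
  refine p.rep_nonzero ((stateCoord V n).injective ?_)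
  rw [map_zero]
  ext i
  exact not_not.1 (h i)

/-- The projective space of `V`, with the standard affine charts. -/
instance Projectivization.instChartedSpaceComplex :
    ChartedSpace (EuclideanSpace ℂ (Fin n)) (ℙ ℂ V) where
  atlas := Set.range (affineChart V)
  chartAt p := affineChart V (exists_mem_affineChart p).choose
  mem_chart_source p := (exists_mem_affineChart p).choose_spec
  chart_mem_atlas _ := Set.mem_range_self _

instance Projectivization.instIsManifoldComplex :
    IsManifold 𝓘(ℝ, EuclideanSpace ℂ (Fin n)) ∞ (ℙ ℂ V) := by
  refine isManifold_of_contDiffOn _ _ _ ?_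
  rintro _ _ ⟨i, rfl⟩ ⟨j, rfl⟩
  have h : ContDiffOn ℂ ∞ (fun z => affineCoord j (affineVec V i z))
      {z | stateCoord V n (affineVec V i z) j ≠ 0} :=
    (contDiffOn_affineCoord j).comp (differentiable_affineVec i).contDiffOn fun z hz => hz
  refine ((h.restrict_scalars ℝ).mono ?_).congr ?_
  · intro z hz
    have hz' : Projectivization.mk ℂ (affineVec V i z) (affineVec_ne_zero i z) ∈
      (affineChart V j).source := by
      have hz2 : z ∈ (affineChart V i).target ∧ (affineChart V i).symm z ∈ (affineChart V j).source := by
        simpa using hz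
      exact hz2.2
    exact (stateCoord_rep_mk j _ _).1 hz'
  · intro z _
    exact affineCoord_rep_mk j _ (affineVec_ne_zero i z)

end

/-- The momentum map `[ψ] ↦ |ψ⟩⟨ψ| / ⟨ψ|ψ⟩`, as a functional on `𝔲(V)`: it takes the value
`⟨ψ|Aψ⟩ / ⟨ψ|ψ⟩` at `iA`. -/
def momentumMap [CompleteSpace V] (p : ℙ ℂ V) : UnitaryDual V :=
  (‖p.rep‖ ^ 2)⁻¹ • (Complex.imCLM ∘L ((innerSL ℂ p.rep).restrictScalars ℝ) ∘L
    ((ContinuousLinearMap.apply ℂ V p.rep).restrictScalars ℝ) ∘L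
    (skewAdjoint.submodule ℝ (V →L[ℂ] V)).subtypeL)

theorem observableHat_momentumMap [CompleteSpace V] (A : Observable V) (v : V) (hv : v ≠ 0) :
    observableHat A (momentumMap (Projectivization.mk ℂ v hv)) =
      (⟪v, A.1 v⟫_ℂ / ⟪v, v⟫_ℂ).re := by
  obtain ⟨c, hc, h⟩ := rep_mk_coord v hv
  have hv2 : ⟪v, v⟫_ℂ = ((‖v‖ ^ 2 : ℝ) : ℂ) := by
    rw [inner_self_eq_norm_sq_to_K]; push_cast; rfl
  have h1 : observableHat A (momentumMap (Projectivization.mk ℂ v hv)) =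
      (‖c • v‖ ^ 2)⁻¹ * (⟪c • v, Complex.I • A.1 (c • v)⟫_ℂ).im := by
    rw [← h]; rfl
  rw [h1, hv2, Complex.div_ofReal_re, norm_smul, map_smul, inner_smul_right, inner_smul_right,
    inner_smul_left]
  have hc' : ‖c‖ ≠ 0 := norm_ne_zero_iff.2 hc
  have h3 : (starRingEnd ℂ) c * c = ((‖c‖ ^ 2 : ℝ) : ℂ) := by
    rw [mul_comm, Complex.mul_conj, Complex.normSq_eq_norm_sq]
  have h2 : Complex.I * (c * ((starRingEnd ℂ) c * ⟪v, A.1 v⟫_ℂ)) =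
      ((‖c‖ ^ 2 : ℝ) : ℂ) * (Complex.I * ⟪v, A.1 v⟫_ℂ) := by
    rw [← h3]; ring
  rw [h2, Complex.im_ofReal_mul, Complex.I_mul_im]
  field_simp

end PureStates

end

/-!
Every anchor in the statement is characterised by a map `J : M → 𝔲*`, and the two Lie algebroids are
instances of one construction. Let `b` be a Lie bracket on `𝔤` and let `J : M → 𝔤*` be smooth. Since
`H ↦ iH/ħ` is a bijection from the observables onto `𝔲`, the Heisenberg equation for `ρ` (with
`𝔤 = 𝔲`) says that `ρ` is `J`-related to the coadjoint fields: `dJ_x (ρ_x ξ) = J(x) ∘ ad ξ`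
(`isHeisenbergAnchor_iff`). If the charts of `M` are, locally, smooth functions of `J`
(`HasSmoothChartInverse`), then `dJ` is injective, so such a `ρ` is unique, and it is smooth, since
in a chart `G ∘ J` it reads `dG ∘ (J ∘ ad)`.

The laws of a Lie algebroid then follow (`isLieAlgebroid_actionBracket`). The identity
`ρ⟦σ, τ⟧ = [ρσ, ρτ]` may be checked after applying the injective map `dJ`. There the Lie bracket
becomes a commutator of derivatives of `J` (`derivAlong_mlieBracket`), and the identity is the
product rule for `x ↦ J(x) ∘ ad (σ x)` together with the Jacobi identity of `b`. The Jacobi identity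
for sections follows from it: the derivative along `ρ⟦σ, τ⟧` is the commutator of those along `ρσ`
and `ρτ`, so that in the cyclic sum all terms with derivatives cancel, and what is left is the
Jacobi identity of `b`.

For `J = id` all this is immediate, and `ρ` is the Hamiltonian vector field because the gradient of
`Â` is `iA`. The Jacobi identity of the Lie-Poisson bracket is that of `b` and the symmetry of the
Hessian (`isPoissonBracket_linearPoisson`).

For the momentum map `m`, the expectation values of the operators `coordOperator` at a unit vector
`v` are the products `conj (v_i) * v_j`; their quotients `v_j / v_i` are the affine coordinates.
Thus `m` has smooth left inverses in the charts, which gives both injectivity and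
`HasSmoothChartInverse`. An anchor exists because the coadjoint field of `ξ` is the image of the
velocity `-ξv` of the flow `exp (-tξ) v` on vectors (`fderiv_vectorMomentum`). The image of `m` is
one orbit since the unitary group acts transitively on unit vectors (`exists_unitary_apply_eq`) and
`m` is equivariant (`vectorMomentum_unitary`).

The bundle of phases is trivialised over the `i`-th affine chart by `ψ ↦ ([ψ], ψ_i / |ψ_i|)`
(`phaseTrivialization`).
-/

noncomputable section

-- the instance problems about the dual of `UnitaryLie V` need this depth
set_option maxSynthPendingDepth 3

/-! ### Derivatives along vector fields -/

section DerivAlong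

variable {E₀ : Type*} [NormedAddCommGroup E₀] [NormedSpace ℝ E₀]
  {H₀ : Type*} [TopologicalSpace H₀] {I : ModelWithCorners ℝ E₀ H₀}
  {M : Type*} [TopologicalSpace M] [ChartedSpace H₀ M]
  {F : Type*} [NormedAddCommGroup F] [NormedSpace ℝ F]

theorem derivAlong_add_right (f : M → F) (x : M) (v w : TangentSpace I x) :
    derivAlong I f x (v + w) = derivAlong I f x v + derivAlong I f x w :=
  map_add (mfderiv I 𝓘(ℝ, F) f x) v w

theorem derivAlong_smul_right (f : M → F) (x : M) (c : ℝ) (v : TangentSpace I x) :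
    derivAlong I f x (c • v) = c • derivAlong I f x v :=
  map_smul (mfderiv I 𝓘(ℝ, F) f x) c v

theorem derivAlong_add {f g : M → F} {x : M} (hf : MDifferentiableAt I 𝓘(ℝ, F) f x)
    (hg : MDifferentiableAt I 𝓘(ℝ, F) g x) (v : TangentSpace I x) :
    derivAlong I (f + g) x v = derivAlong I f x v + derivAlong I g x v := by
  have h := (hf.hasMFDerivAt.add hg.hasMFDerivAt).mfderiv
  unfold derivAlong
  rw [h]
  rfl

theorem derivAlong_sub {f g : M → F} {x : M} (hf : MDifferentiableAt I 𝓘(ℝ, F) f x)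
    (hg : MDifferentiableAt I 𝓘(ℝ, F) g x) (v : TangentSpace I x) :
    derivAlong I (f - g) x v = derivAlong I f x v - derivAlong I g x v := by
  have h := (hf.hasMFDerivAt.sub hg.hasMFDerivAt).mfderiv
  unfold derivAlong
  rw [h]
  rfl

theorem derivAlong_const_smul {f : M → F} {x : M} (c : ℝ) (hf : MDifferentiableAt I 𝓘(ℝ, F) f x)
    (v : TangentSpace I x) :
    derivAlong I (c • f) x v = c • derivAlong I f x v := by
  have h := (hf.hasMFDerivAt.const_smul c).mfderiv
  unfold derivAlong
  rw [h]
  rfl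

/-- The chain rule for the composition with a map between normed spaces. -/
theorem derivAlong_comp {G : Type*} [NormedAddCommGroup G] [NormedSpace ℝ G] {g : F → G}
    {f : M → F} {x : M} (hg : DifferentiableAt ℝ g (f x))
    (hf : MDifferentiableAt I 𝓘(ℝ, F) f x) (v : TangentSpace I x) :
    derivAlong I (fun y => g (f y)) x v = fderiv ℝ g (f x) (derivAlong I f x v) := by
  have h := (hg.mdifferentiableAt.hasMFDerivAt.comp x hf.hasMFDerivAt).mfderiv
  unfold derivAlong
  rw [show (fun y => g (f y)) = g ∘ f from rfl, h, mfderiv_eq_fderiv]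
  rfl

/-- The product rule for a bounded bilinear map. -/
theorem derivAlong_bilin {G K : Type*} [NormedAddCommGroup G] [NormedSpace ℝ G]
    [NormedAddCommGroup K] [NormedSpace ℝ K] (B : F →L[ℝ] G →L[ℝ] K) {f : M → F} {g : M → G} {x : M}
    (hf : MDifferentiableAt I 𝓘(ℝ, F) f x) (hg : MDifferentiableAt I 𝓘(ℝ, G) g x)
    (v : TangentSpace I x) :
    derivAlong I (fun y => B (f y) (g y)) x v =
      B (derivAlong I f x v) (g x) + B (f x) (derivAlong I g x v) := by
  have hp : MDifferentiableAt I 𝓘(ℝ, F × G) (fun y => (f y, g y)) x := hf.prodMk_space hg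
  have hB := B.isBoundedBilinearMap.hasFDerivAt (f x, g x)
  rw [derivAlong_comp (g := fun p : F × G => B p.1 p.2) (f := fun y => (f y, g y))
    hB.differentiableAt hp, hB.fderiv, IsBoundedBilinearMap.deriv_apply, add_comm]
  have h1 := derivAlong_comp (g := (Prod.fst : F × G → F)) differentiableAt_fst hp v
  have h2 := derivAlong_comp (g := (Prod.snd : F × G → G)) differentiableAt_snd hp v
  rw [fderiv_fst] at h1
  rw [fderiv_snd] at h2
  exact congrArg₂ (fun a b => B a (g x) + B (f x) b) h1.symm h2.symm

variable [IsManifold I ∞ M]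

theorem contMDiff_derivAlong {E₁ : Type*} [NormedAddCommGroup E₁] [NormedSpace ℝ E₁]
    {H₁ : Type*} [TopologicalSpace H₁] {I' : ModelWithCorners ℝ E₁ H₁}
    {N : Type*} [TopologicalSpace N] [ChartedSpace H₁ N]
    {f : M → F} (hf : ContMDiff I 𝓘(ℝ, F) ∞ f) {X : N → TangentBundle I M}
    (hX : ContMDiff I' I.tangent ∞ X) :
    ContMDiff I' 𝓘(ℝ, F) ∞ (fun y => derivAlong I f (X y).1 (X y).2) := by
  have : IsManifold I 1 M := IsManifold.of_le (n := ∞) (by simp)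
  have h := (hf.contMDiff_tangentMap (m := ∞) (by simp)).comp hX
  exact (contMDiff_snd_tangentBundle_modelSpace F 𝓘(ℝ, F)).comp h

/-- In a normed space, the derivative along the Lie bracket of two vector fields is the commutator
of the derivatives along them. -/
theorem fderiv_lieBracket {g : E₀ → F} {V W : E₀ → E₀} {z : E₀} (hg : ContDiffAt ℝ 2 g z)
    (hV : DifferentiableAt ℝ V z) (hW : DifferentiableAt ℝ W z) :
    fderiv ℝ g z (VectorField.lieBracket ℝ V W z) =
      fderiv ℝ (fun y => fderiv ℝ g y (W y)) z (V z) -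
        fderiv ℝ (fun y => fderiv ℝ g y (V y)) z (W z) := by
  have hg' : DifferentiableAt ℝ (fderiv ℝ g) z :=
    (hg.fderiv_right (m := 1) (by norm_num)).differentiableAt (by simp)
  have hs : IsSymmSndFDerivAt ℝ g z := hg.isSymmSndFDerivAt (by simp)
  rw [VectorField.lieBracket_eq, fderiv_clm_apply hg' hW, fderiv_clm_apply hg' hV]
  simp [hs.eq (V z) (W z)]

/-- Derivatives along a vector field may be computed in a chart. -/
theorem fderiv_comp_extChartAt_symm [I.Boundaryless] {f : M → F} (x : M)
    (V : ∀ y, TangentSpace I y) {z : E₀} (hz : z ∈ (extChartAt I x).target)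
    (hf : MDifferentiableAt I 𝓘(ℝ, F) f ((extChartAt I x).symm z)) :
    fderiv ℝ (f ∘ (extChartAt I x).symm) z
      (VectorField.mpullbackWithin 𝓘(ℝ, E₀) I (extChartAt I x).symm V (Set.range I) z) =
    derivAlong I f ((extChartAt I x).symm z) (V ((extChartAt I x).symm z)) := by
  have : IsManifold I 1 M := IsManifold.of_le (n := ∞) (by simp)
  have hd : MDifferentiableAt 𝓘(ℝ, E₀) I (extChartAt I x).symm z := by
    have h := mdifferentiableWithinAt_extChartAt_symm (I := I) hz
    rwa [I.range_eq_univ, mdifferentiableWithinAt_univ] at h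
  have hi := isInvertible_mfderivWithin_extChartAt_symm (I := I) hz
  rw [VectorField.mpullbackWithin_apply]
  rw [I.range_eq_univ, mfderivWithin_univ] at hi ⊢
  have h := (hf.hasMFDerivAt.comp z hd.hasMFDerivAt).mfderiv
  rw [mfderiv_eq_fderiv] at h
  rw [h]
  change mfderiv I 𝓘(ℝ, F) f _ (mfderiv 𝓘(ℝ, E₀) I (extChartAt I x).symm z
    ((mfderiv 𝓘(ℝ, E₀) I (extChartAt I x).symm z).inverse (V ((extChartAt I x).symm z)))) = _
  have h2 : mfderiv 𝓘(ℝ, E₀) I (extChartAt I x).symm z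
    ((mfderiv 𝓘(ℝ, E₀) I (extChartAt I x).symm z).inverse (V ((extChartAt I x).symm z))) =
      V ((extChartAt I x).symm z) := by
    exact DFunLike.congr_fun hi.self_comp_inverse _
  rw [h2]
  rfl

/-- On a manifold, the derivative of a smooth function along the Lie bracket of two smooth vector
fields is the commutator of the derivatives along them. Both sides are computed in the chart centred
at `x`, where this is `fderiv_lieBracket`. -/
theorem derivAlong_mlieBracket [I.Boundaryless] [CompleteSpace E₀] {f : M → F}
    (hf : ContMDiff I 𝓘(ℝ, F) ∞ f) {V W : ∀ y, TangentSpace I y}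
    (hV : ContMDiff I I.tangent ∞ (fun y => (⟨y, V y⟩ : TangentBundle I M)))
    (hW : ContMDiff I I.tangent ∞ (fun y => (⟨y, W y⟩ : TangentBundle I M))) (x : M) :
    derivAlong I f x (VectorField.mlieBracket I V W x) =
      derivAlong I (fun y => derivAlong I f y (W y)) x (V x) -
        derivAlong I (fun y => derivAlong I f y (V y)) x (W x) := by
  have : IsManifold I 2 M := IsManifold.of_le (n := ∞) ENat.LEInfty.out
  have : IsManifold I 1 M := IsManifold.of_le (n := ∞) (by simp)
  set φ := (extChartAt I x).symm with hφ
  set z := extChartAt I x x with hz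
  have hzt : z ∈ (extChartAt I x).target := mem_extChartAt_target x
  have hφz : φ z = x := extChartAt_to_inv x
  have hev : ∀ᶠ y in nhds z, y ∈ (extChartAt I x).target :=
    extChartAt_target_mem_nhds (I := I) x
  set V' := VectorField.mpullbackWithin 𝓘(ℝ, E₀) I φ V (Set.range I) with hV'
  set W' := VectorField.mpullbackWithin 𝓘(ℝ, E₀) I φ W (Set.range I) with hW'
  have hdiff : ∀ {U : ∀ y, TangentSpace I y},
      ContMDiff I I.tangent ∞ (fun y => (⟨y, U y⟩ : TangentBundle I M)) →
      DifferentiableAt ℝ (VectorField.mpullbackWithin 𝓘(ℝ, E₀) I φ U (Set.range I)) z := by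
    intro U hU
    have h := MDifferentiableWithinAt.differentiableWithinAt_mpullbackWithin_vectorField
      (I := I) (V := U) (s := Set.univ) (x := x)
      (mdifferentiableWithinAt_univ.2 (hU.mdifferentiableAt (by simp)))
    rw [Set.preimage_univ, Set.univ_inter] at h
    exact (h.mono (s := Set.univ) (by rw [I.range_eq_univ])).differentiableAt Filter.univ_mem
  have hg : ContDiffAt ℝ ∞ (f ∘ φ) z := by
    have h1 : ContMDiffAt 𝓘(ℝ, E₀) I ∞ φ z := by
      have h := contMDiffWithinAt_extChartAt_symm_range (I := I) (n := ∞) x hzt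
      rwa [I.range_eq_univ, contMDiffWithinAt_univ] at h
    exact (hf.contMDiffAt.comp z h1).contDiffAt
  have hfd : ∀ y, MDifferentiableAt I 𝓘(ℝ, F) f y := fun y => hf.mdifferentiableAt (by simp)
  have key : ∀ {U : ∀ y, TangentSpace I y} {X : ∀ y, TangentSpace I y},
      ContMDiff I I.tangent ∞ (fun y => (⟨y, U y⟩ : TangentBundle I M)) →
      fderiv ℝ (fun y => fderiv ℝ (f ∘ φ) y
          (VectorField.mpullbackWithin 𝓘(ℝ, E₀) I φ U (Set.range I) y)) z
        (VectorField.mpullbackWithin 𝓘(ℝ, E₀) I φ X (Set.range I) z) =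
      derivAlong I (fun y => derivAlong I f y (U y)) x (X x) := by
    intro U X hU
    have h1 : (fun y => fderiv ℝ (f ∘ φ) y
        (VectorField.mpullbackWithin 𝓘(ℝ, E₀) I φ U (Set.range I) y)) =ᶠ[nhds z]
        (fun y => derivAlong I f y (U y)) ∘ φ := by
      filter_upwards [hev] with y hy
      exact fderiv_comp_extChartAt_symm x U hy (hfd _)
    rw [h1.fderiv_eq, fderiv_comp_extChartAt_symm x X hzt, ← hφ, hφz]
    exact (contMDiff_derivAlong hf hU).mdifferentiableAt (by simp)
  rw [← key hW, ← key hV, ← fderiv_lieBracket (hg.of_le ENat.LEInfty.out) (hdiff hV)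
    (hdiff hW)]
  have hfx : mfderiv I 𝓘(ℝ, F) f x = (fderiv ℝ (f ∘ φ) z).comp
      (mfderiv I 𝓘(ℝ, E₀) (extChartAt I x) x) := by
    have h1 : f =ᶠ[nhds x] (f ∘ φ) ∘ extChartAt I x := by
      filter_upwards [extChartAt_source_mem_nhds (I := I) x] with y hy
      simp only [Function.comp, hφ]
      rw [(extChartAt I x).left_inv hy]
    rw [h1.mfderiv_eq, ← mfderiv_eq_fderiv]
    exact mfderiv_comp x (hg.differentiableAt (by simp)).mdifferentiableAt
      (mdifferentiableAt_extChartAt (mem_chart_source H₀ x))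
  have hi := isInvertible_mfderiv_extChartAt (I := I) (mem_extChartAt_source x)
  rw [derivAlong, hfx, ← VectorField.mlieBracketWithin_univ, VectorField.mlieBracketWithin_apply,
    Set.preimage_univ, Set.univ_inter]
  change fderiv ℝ (f ∘ φ) z (mfderiv I 𝓘(ℝ, E₀) (extChartAt I x) x
    ((mfderiv I 𝓘(ℝ, E₀) (extChartAt I x) x).inverse _)) = _
  have h2 := DFunLike.congr_fun hi.self_comp_inverse
    (VectorField.lieBracketWithin ℝ V' W' (Set.range I) z)
  have h3 : VectorField.lieBracketWithin ℝ V' W' (Set.range I) z =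
      VectorField.lieBracket ℝ V' W' z := by
    rw [I.range_eq_univ]
    exact congrFun (VectorField.lieBracketWithin_univ (V := V') (W := W')) z
  rw [← h3]
  exact congrArg (fderiv ℝ (f ∘ φ) z) h2

end DerivAlong

/-! ### The Lie-Poisson bracket of a finite-dimensional Lie algebra -/

section LinearPoisson

variable {𝔤 : Type*} [NormedAddCommGroup 𝔤] [NormedSpace ℝ 𝔤]

/-- The bounded bilinear map `(ζ, ξ) ↦ ζ ∘ ad ξ`, for a bracket `b` on `𝔤`. It is the infinitesimal
coadjoint action, with the sign for which `ξ ↦ (ζ ↦ ζ ∘ ad ξ)` is a homomorphism from `𝔤` to the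
vector fields on `𝔤*`. -/
def coadjointField (b : 𝔤 →L[ℝ] 𝔤 →L[ℝ] 𝔤) :
    StrongDual ℝ 𝔤 →L[ℝ] 𝔤 →L[ℝ] StrongDual ℝ 𝔤 :=
  ((ContinuousLinearMap.compL ℝ 𝔤 (𝔤 →L[ℝ] 𝔤) (StrongDual ℝ 𝔤)).flip b).comp
    (ContinuousLinearMap.compL ℝ 𝔤 𝔤 ℝ)

theorem coadjointField_apply (b : 𝔤 →L[ℝ] 𝔤 →L[ℝ] 𝔤) (ζ : StrongDual ℝ 𝔤) (ξ η : 𝔤) :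
    coadjointField b ζ ξ η = ζ (b ξ η) := rfl

variable [FiniteDimensional ℝ 𝔤]

theorem exists_bidual_inverse (𝔤 : Type*) [NormedAddCommGroup 𝔤] [NormedSpace ℝ 𝔤]
    [FiniteDimensional ℝ 𝔤] :
    ∃ D : StrongDual ℝ (StrongDual ℝ 𝔤) →L[ℝ] 𝔤,
      ∀ (φ : StrongDual ℝ (StrongDual ℝ 𝔤)) (η : StrongDual ℝ 𝔤), η (D φ) = φ η := by
  let j : 𝔤 →ₗ[ℝ] StrongDual ℝ (StrongDual ℝ 𝔤) :=
    (NormedSpace.inclusionInDoubleDual ℝ 𝔤).toLinearMap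
  have hj : Function.Injective j := (NormedSpace.inclusionInDoubleDualLi ℝ).injective
  have hdual : ∀ (E : Type _) [NormedAddCommGroup E] [NormedSpace ℝ E] [FiniteDimensional ℝ E],
      Module.finrank ℝ (StrongDual ℝ E) = Module.finrank ℝ E := by
    intro E _ _ _
    rw [← LinearEquiv.finrank_eq (LinearMap.toContinuousLinearMap : (E →ₗ[ℝ] ℝ) ≃ₗ[ℝ] _)]
    exact Subspace.dual_finrank_eq
  have hd : Module.finrank ℝ 𝔤 = Module.finrank ℝ (StrongDual ℝ (StrongDual ℝ 𝔤)) := by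
    rw [hdual (StrongDual ℝ 𝔤), hdual 𝔤]
  let e := LinearEquiv.ofInjectiveOfFinrankEq j hj hd
  refine ⟨LinearMap.toContinuousLinearMap e.symm.toLinearMap, fun φ η => ?_⟩
  have h := DFunLike.congr_fun (e.apply_symm_apply φ) η
  exact h

variable (𝔤) in
/-- The identification `𝔤** ≅ 𝔤`. -/
def bidualInverse : StrongDual ℝ (StrongDual ℝ 𝔤) →L[ℝ] 𝔤 :=
  (exists_bidual_inverse 𝔤).choose

theorem apply_bidualInverse (φ : StrongDual ℝ (StrongDual ℝ 𝔤)) (η : StrongDual ℝ 𝔤) :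
    η (bidualInverse 𝔤 φ) = φ η :=
  (exists_bidual_inverse 𝔤).choose_spec φ η

/-- The differential at `ζ` of a function on `𝔤*`, as an element of `𝔤 ≅ 𝔤**`. -/
def gradientOnDual (f : StrongDual ℝ 𝔤 → ℝ) (ζ : StrongDual ℝ 𝔤) : 𝔤 :=
  bidualInverse 𝔤 (fderiv ℝ f ζ)

theorem apply_gradientOnDual (f : StrongDual ℝ 𝔤 → ℝ) (ζ η : StrongDual ℝ 𝔤) :
    η (gradientOnDual f ζ) = fderiv ℝ f ζ η :=
  apply_bidualInverse _ _

theorem eq_gradientOnDual {f : StrongDual ℝ 𝔤 → ℝ} {ζ : StrongDual ℝ 𝔤} {ξ : 𝔤}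
    (h : ∀ η : StrongDual ℝ 𝔤, η ξ = fderiv ℝ f ζ η) : ξ = gradientOnDual f ζ :=
  (SeparatingDual.eq_iff_forall_dual_eq (R := ℝ)).2 fun η => by rw [h, apply_gradientOnDual]

theorem contDiff_gradientOnDual {f : StrongDual ℝ 𝔤 → ℝ} (hf : ContDiff ℝ ∞ f) :
    ContDiff ℝ ∞ (gradientOnDual f) :=
  (bidualInverse 𝔤).contDiff.comp (hf.fderiv_right (by simp))

/-- The Hessian of `f`, expressed by the derivative of the gradient, is symmetric. -/
theorem apply_fderiv_gradientOnDual_comm {f : StrongDual ℝ 𝔤 → ℝ} (hf : ContDiff ℝ ∞ f)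
    (ζ η θ : StrongDual ℝ 𝔤) :
    θ (fderiv ℝ (gradientOnDual f) ζ η) = η (fderiv ℝ (gradientOnDual f) ζ θ) := by
  have hd : Differentiable ℝ (fderiv ℝ f) :=
    (hf.fderiv_right (m := ∞) (by simp)).differentiable (by simp)
  have h : ∀ θ η : StrongDual ℝ 𝔤, θ (fderiv ℝ (gradientOnDual f) ζ η) =
      fderiv ℝ (fderiv ℝ f) ζ η θ := by
    intro θ η
    have h1 : HasFDerivAt (gradientOnDual f) ((bidualInverse 𝔤).comp (fderiv ℝ (fderiv ℝ f) ζ)) ζ :=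
      (bidualInverse 𝔤).hasFDerivAt.comp ζ (hd ζ).hasFDerivAt
    rw [h1.fderiv]
    exact apply_bidualInverse _ _
  rw [h, h]
  exact (hf.contDiffAt.isSymmSndFDerivAt (by simpa using ENat.LEInfty.out)).eq η θ

/-- The Lie-Poisson bracket of a bracket `b` on `𝔤`. -/
def linearPoisson (b : 𝔤 →L[ℝ] 𝔤 →L[ℝ] 𝔤) (f g : StrongDual ℝ 𝔤 → ℝ) (ζ : StrongDual ℝ 𝔤) : ℝ :=
  ζ (b (gradientOnDual f ζ) (gradientOnDual g ζ))

/-- The Hamiltonian vector field of `f` is the coadjoint field of the differential of `f`. -/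
theorem linearPoisson_eq_fderiv (b : 𝔤 →L[ℝ] 𝔤 →L[ℝ] 𝔤) (f g : StrongDual ℝ 𝔤 → ℝ)
    (ζ : StrongDual ℝ 𝔤) :
    linearPoisson b f g ζ = fderiv ℝ g ζ (coadjointField b ζ (gradientOnDual f ζ)) := by
  rw [← apply_gradientOnDual]
  rfl

theorem contDiff_linearPoisson (b : 𝔤 →L[ℝ] 𝔤 →L[ℝ] 𝔤) {f g : StrongDual ℝ 𝔤 → ℝ}
    (hf : ContDiff ℝ ∞ f) (hg : ContDiff ℝ ∞ g) : ContDiff ℝ ∞ (linearPoisson b f g) :=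
  ((coadjointField b).contDiff.clm_apply (contDiff_gradientOnDual hf)).clm_apply
    (contDiff_gradientOnDual hg)

/-- The iterated Lie-Poisson bracket in terms of first and second derivatives: the terms with second
derivatives cancel in the cyclic sum because the Hessians are symmetric. -/
theorem linearPoisson_linearPoisson {b : 𝔤 →L[ℝ] 𝔤 →L[ℝ] 𝔤} (hskew : ∀ ξ η, b ξ η = -b η ξ)
    {f g : StrongDual ℝ 𝔤 → ℝ} (h : StrongDual ℝ 𝔤 → ℝ) (hf : ContDiff ℝ ∞ f)
    (hg : ContDiff ℝ ∞ g) (ζ : StrongDual ℝ 𝔤) :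
    linearPoisson b h (linearPoisson b f g) ζ =
      ζ (b (gradientOnDual h ζ) (b (gradientOnDual f ζ) (gradientOnDual g ζ))) -
      coadjointField b ζ (gradientOnDual g ζ)
        (fderiv ℝ (gradientOnDual f) ζ (coadjointField b ζ (gradientOnDual h ζ))) +
      coadjointField b ζ (gradientOnDual f ζ)
        (fderiv ℝ (gradientOnDual g) ζ (coadjointField b ζ (gradientOnDual h ζ))) := by
  have hf' : DifferentiableAt ℝ (gradientOnDual f) ζ :=
    (contDiff_gradientOnDual hf).differentiable (by simp) ζ
  have hg' : DifferentiableAt ℝ (gradientOnDual g) ζ :=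
    (contDiff_gradientOnDual hg).differentiable (by simp) ζ
  have hB : HasFDerivAt (fun ζ => coadjointField b ζ (gradientOnDual f ζ)) _ ζ :=
    (coadjointField b).hasFDerivAt.clm_apply hf'.hasFDerivAt
  have hD := (hB.clm_apply hg'.hasFDerivAt).fderiv
  rw [linearPoisson_eq_fderiv]
  rw [show linearPoisson b f g =
    fun ζ => coadjointField b ζ (gradientOnDual f ζ) (gradientOnDual g ζ) from rfl, hD]
  simp only [add_apply, ContinuousLinearMap.comp_apply,
    ContinuousLinearMap.flip_apply, coadjointField_apply]
  rw [hskew (gradientOnDual g ζ) (fderiv ℝ (gradientOnDual f) ζ _), map_neg]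
  ring

theorem linearPoisson_jacobi {b : 𝔤 →L[ℝ] 𝔤 →L[ℝ] 𝔤} (hskew : ∀ ξ η, b ξ η = -b η ξ)
    (hjac : ∀ ξ η θ, b ξ (b η θ) + b η (b θ ξ) + b θ (b ξ η) = 0) {f g h : StrongDual ℝ 𝔤 → ℝ}
    (hf : ContDiff ℝ ∞ f) (hg : ContDiff ℝ ∞ g) (hh : ContDiff ℝ ∞ h) :
    linearPoisson b f (linearPoisson b g h) + linearPoisson b g (linearPoisson b h f) +
      linearPoisson b h (linearPoisson b f g) = 0 := by
  funext ζ
  simp only [Pi.add_apply, Pi.zero_apply]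
  rw [linearPoisson_linearPoisson hskew f hg hh, linearPoisson_linearPoisson hskew g hh hf,
    linearPoisson_linearPoisson hskew h hf hg,
    apply_fderiv_gradientOnDual_comm hf ζ (coadjointField b ζ (gradientOnDual g ζ)),
    apply_fderiv_gradientOnDual_comm hg ζ (coadjointField b ζ (gradientOnDual h ζ)),
    apply_fderiv_gradientOnDual_comm hh ζ (coadjointField b ζ (gradientOnDual f ζ))]
  have hj := congrArg ζ (hjac (gradientOnDual f ζ) (gradientOnDual g ζ) (gradientOnDual h ζ))
  simp only [map_add, map_zero] at hj
  linear_combination hj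

theorem isPoissonBracket_linearPoisson {b : 𝔤 →L[ℝ] 𝔤 →L[ℝ] 𝔤} (hskew : ∀ ξ η, b ξ η = -b η ξ)
    (hjac : ∀ ξ η θ, b ξ (b η θ) + b η (b θ ξ) + b θ (b ξ η) = 0) :
    IsPoissonBracket 𝓘(ℝ, StrongDual ℝ 𝔤) (linearPoisson b) where
  smooth f g hf hg := (contDiff_linearPoisson b hf.contDiff hg.contDiff).contMDiff
  add_left f g h hf hg _ := by
    funext ζ
    simp only [linearPoisson, Pi.add_apply, gradientOnDual]
    rw [fderiv_add (hf.contDiff.differentiable (by simp) ζ)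
      (hg.contDiff.differentiable (by simp) ζ)]
    simp
  smul_left c f g hf _ := by
    funext ζ
    simp only [linearPoisson, Pi.smul_apply, gradientOnDual]
    rw [fderiv_const_smul (hf.contDiff.differentiable (by simp) ζ)]
    simp
  skew f g _ _ := by
    funext ζ
    rw [linearPoisson, hskew, map_neg]
    rfl
  leibniz f g h hf hg _ := by
    funext ζ
    simp only [linearPoisson, Pi.add_apply, Pi.mul_apply, gradientOnDual]
    rw [fderiv_mul (hf.contDiff.differentiable (by simp) ζ)
      (hg.contDiff.differentiable (by simp) ζ)]
    simp
  jacobi f g h hf hg hh := linearPoisson_jacobi hskew hjac hf.contDiff hg.contDiff hh.contDiff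

end LinearPoisson

/-! ### Observables and the Lie algebra of the unitary group -/

section Unitary

variable {V : Type*} [NormedAddCommGroup V] [InnerProductSpace ℂ V] [CompleteSpace V]

theorem UnitaryLie.coe_lie (ξ η : UnitaryLie V) :
    (⁅ξ, η⁆ : UnitaryLie V).1 = ξ.1 * η.1 - η.1 * ξ.1 :=
  rfl

variable (V) in
/-- The bracket of `𝔲(V)` as a bounded bilinear map. -/
def unitaryBracket : UnitaryLie V →L[ℝ] UnitaryLie V →L[ℝ] UnitaryLie V :=
  LinearMap.mkContinuous₂
    (LinearMap.mk₂ ℝ (fun ξ η : UnitaryLie V => ⁅ξ, η⁆) add_lie smul_lie lie_add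
      (fun c ξ η => lie_smul c ξ η)) 2 fun ξ η => by
    change ‖ξ.1 * η.1 - η.1 * ξ.1‖ ≤ 2 * ‖ξ.1‖ * ‖η.1‖
    have h1 := norm_mul_le ξ.1 η.1
    have h2 := norm_mul_le η.1 ξ.1
    have h3 := norm_sub_le (ξ.1 * η.1) (η.1 * ξ.1)
    linarith

theorem unitaryBracket_apply (ξ η : UnitaryLie V) : unitaryBracket V ξ η = ⁅ξ, η⁆ := rfl

theorem unitaryBracket_skew (ξ η : UnitaryLie V) :
    unitaryBracket V ξ η = -unitaryBracket V η ξ := by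
  rw [unitaryBracket_apply, unitaryBracket_apply, lie_skew]

theorem unitaryBracket_jacobi (ξ η θ : UnitaryLie V) :
    unitaryBracket V ξ (unitaryBracket V η θ) + unitaryBracket V η (unitaryBracket V θ ξ) +
      unitaryBracket V θ (unitaryBracket V ξ η) = 0 :=
  lie_jacobi ξ η θ

theorem observableToLie_surjective :
    Function.Surjective (observableToLie : Observable V → UnitaryLie V) := by
  intro ξ
  have hξ : star ξ.1 = -ξ.1 := ξ.2
  refine ⟨⟨(-Complex.I) • ξ.1, ?_⟩, ?_⟩
  · change star _ = _
    simp [star_smul, hξ]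
  · apply Subtype.ext
    change Complex.I • ((-Complex.I) • ξ.1) = ξ.1
    rw [smul_smul]
    simp

theorem observableToLie_injective :
    Function.Injective (observableToLie : Observable V → UnitaryLie V) := by
  intro A B h
  have h1 : Complex.I • A.1 = Complex.I • B.1 := congrArg Subtype.val h
  exact Subtype.ext (smul_right_injective _ Complex.I_ne_zero h1)

theorem hamiltonianElement_bijective {ħ : ℝ} (hħ : ħ ≠ 0) :
    Function.Bijective (hamiltonianElement ħ : Observable V → UnitaryLie V) :=
  ⟨(smul_right_injective _ (inv_ne_zero hħ)).comp observableToLie_injective, fun ξ => by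
    obtain ⟨A, hA⟩ := observableToLie_surjective (ħ • ξ)
    exact ⟨A, by rw [hamiltonianElement, hA, inv_smul_smul₀ hħ]⟩⟩

/-- The right-hand side of the Heisenberg equation is the adjoint action of the generator of the
time evolution. -/
theorem observableToLie_heisenbergRHS (ħ : ℝ) (H A : Observable V) :
    observableToLie (heisenbergRHS ħ H A) =
      unitaryBracket V (hamiltonianElement ħ H) (observableToLie A) := by
  apply Subtype.ext
  rw [unitaryBracket_apply, UnitaryLie.coe_lie]
  change Complex.I • ((Complex.I * (ħ : ℂ))⁻¹ • (A.1 * H.1 - H.1 * A.1)) =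
    (ħ⁻¹ • (Complex.I • H.1)) * (Complex.I • A.1) - (Complex.I • A.1) * (ħ⁻¹ • (Complex.I • H.1))
  have h : Complex.I * (Complex.I * (ħ : ℂ))⁻¹ = ((ħ⁻¹ : ℝ) : ℂ) := by
    rw [mul_inv, ← mul_assoc, mul_inv_cancel₀ Complex.I_ne_zero, one_mul, Complex.ofReal_inv]
  have h2 : ∀ T : V →L[ℂ] V, (ħ⁻¹ : ℝ) • T = ((ħ⁻¹ : ℝ) : ℂ) • T := fun T => rfl
  have h3 : Complex.I * (((ħ⁻¹ : ℝ) : ℂ) * Complex.I) = -((ħ⁻¹ : ℝ) : ℂ) := by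
    linear_combination ((ħ⁻¹ : ℝ) : ℂ) * Complex.I_mul_I
  have h4 : ((ħ⁻¹ : ℝ) : ℂ) * Complex.I * Complex.I = -((ħ⁻¹ : ℝ) : ℂ) := by
    linear_combination ((ħ⁻¹ : ℝ) : ℂ) * Complex.I_mul_I
  rw [smul_smul, h, h2]
  simp only [smul_mul_assoc, mul_smul_comm, smul_smul, h3, h4, smul_sub, neg_smul]
  abel

theorem lie_hamiltonianElement (ħ : ℝ) (H K : Observable V) :
    ⁅hamiltonianElement ħ H, hamiltonianElement ħ K⁆ =
      hamiltonianElement ħ (heisenbergRHS ħ H K) := by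
  rw [hamiltonianElement.eq_1 ħ K, hamiltonianElement.eq_1 ħ (heisenbergRHS ħ H K),
    observableToLie_heisenbergRHS]
  exact lie_smul _ _ _

theorem observableHat_heisenbergRHS (ħ : ℝ) (H A : Observable V) (ζ : UnitaryDual V) :
    observableHat (heisenbergRHS ħ H A) ζ =
      coadjointField (unitaryBracket V) ζ (hamiltonianElement ħ H) (observableToLie A) := by
  rw [observableHat, observableToLie_heisenbergRHS]
  rfl

variable [FiniteDimensional ℂ V]

theorem dualGradient_eq_gradientOnDual (f : UnitaryDual V → ℝ) :
    dualGradient f = gradientOnDual f :=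
  funext fun ζ => eq_gradientOnDual fun η => apply_dualGradient f ζ η

theorem liePoisson_eq_linearPoisson :
    (liePoisson : (UnitaryDual V → ℝ) → _) = linearPoisson (unitaryBracket V) := by
  funext f g ζ
  rw [liePoisson, dualGradient_eq_gradientOnDual, dualGradient_eq_gradientOnDual]
  rfl

theorem isPoissonBracket_liePoisson :
    IsPoissonBracket 𝓘(ℝ, UnitaryDual V) (liePoisson (V := V)) := by
  rw [liePoisson_eq_linearPoisson]
  exact isPoissonBracket_linearPoisson unitaryBracket_skew unitaryBracket_jacobi

theorem gradientOnDual_observableHat (A : Observable V) (ζ : UnitaryDual V) :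
    gradientOnDual (observableHat A) ζ = observableToLie A := by
  refine (eq_gradientOnDual fun η => ?_).symm
  exact (DFunLike.congr_fun
    (ContinuousLinearMap.fderiv (ContinuousLinearMap.apply ℝ ℝ (observableToLie A)) (x := ζ))
    η).symm

theorem liePoisson_observableHat (ħ : ℝ) (H A : Observable V) :
    ħ⁻¹ • liePoisson (observableHat H) (observableHat A) = observableHat (heisenbergRHS ħ H A) := by
  funext ζ
  rw [Pi.smul_apply, liePoisson_eq_linearPoisson, linearPoisson, gradientOnDual_observableHat,
    gradientOnDual_observableHat, observableHat_heisenbergRHS, coadjointField_apply,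
    hamiltonianElement, map_smul, ← map_smul]
  rfl

end Unitary

/-! ### Lie algebroids over a manifold with an immersion into the dual of a Lie algebra -/

section TrivialBundle

variable {E₀ : Type*} [NormedAddCommGroup E₀] [NormedSpace ℝ E₀]
  {H₀ : Type*} [TopologicalSpace H₀] {I : ModelWithCorners ℝ E₀ H₀}
  {M : Type*} [TopologicalSpace M] [ChartedSpace H₀ M]
  {F : Type*} [NormedAddCommGroup F] [NormedSpace ℝ F]

theorem isSmoothSection_trivial_iff {σ : M → F} :
    IsSmoothSection I F (Trivial M F) σ ↔ ContMDiff I 𝓘(ℝ, F) ∞ σ := by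
  refine ⟨fun h x => ((contMDiffAt_totalSpace (E := Trivial M F)).1 (h x)).2, fun h x => ?_⟩
  exact (contMDiffAt_totalSpace (E := Trivial M F)).2 ⟨contMDiffAt_id, h x⟩

theorem contMDiff_snd_trivial :
    ContMDiff (I.prod 𝓘(ℝ, F)) 𝓘(ℝ, F) ∞ (fun v : TotalSpace F (Trivial M F) => v.2) :=
  fun x => ((contMDiffAt_totalSpace (E := Trivial M F)).1 (contMDiff_id x)).2

end TrivialBundle

section ActionAlgebroid

variable {E₀ : Type*} [NormedAddCommGroup E₀] [NormedSpace ℝ E₀]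
  {H₀ : Type*} [TopologicalSpace H₀] {I : ModelWithCorners ℝ E₀ H₀}
  {M : Type*} [TopologicalSpace M] [ChartedSpace H₀ M]
  {D : Type*} [NormedAddCommGroup D] [NormedSpace ℝ D]

/-- Near every point, the chart centred there is a smooth function of `J`. Such a `J` is an
immersion. -/
def HasSmoothChartInverse (I : ModelWithCorners ℝ E₀ H₀) (J : M → D) : Prop :=
  ∀ x₀ : M, ∃ G : D → E₀, ContDiffAt ℝ ∞ G (J x₀) ∧
    ∀ᶠ x in nhds x₀, G (J x) = extChartAt I x₀ x

variable [IsManifold I ∞ M]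

theorem HasSmoothChartInverse.derivAlong_injective {J : M → D} (hG : HasSmoothChartInverse I J)
    (hJ : ContMDiff I 𝓘(ℝ, D) ∞ J) (x : M) : Function.Injective (derivAlong I J x) := by
  have : IsManifold I 1 M := IsManifold.of_le (n := ∞) (by simp)
  obtain ⟨G, hGd, hGe⟩ := hG x
  have hinj : Function.Injective (derivAlong I (extChartAt I x) x) := by
    obtain ⟨e, he⟩ := isInvertible_mfderiv_extChartAt (I := I) (mem_extChartAt_source x)
    intro v w h
    refine e.injective ?_
    have h' : mfderiv I 𝓘(ℝ, E₀) (extChartAt I x) x v =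
      mfderiv I 𝓘(ℝ, E₀) (extChartAt I x) x w := h
    rw [← he] at h'
    exact h'
  have hchain : ∀ v, derivAlong I (extChartAt I x) x v = fderiv ℝ G (J x) (derivAlong I J x v) := by
    intro v
    rw [← derivAlong_comp (hGd.differentiableAt (by simp)) (hJ.mdifferentiableAt (by simp))]
    unfold derivAlong
    rw [Filter.EventuallyEq.mfderiv_eq hGe]
    rfl
  intro v w h
  exact hinj (by rw [hchain, hchain, h])

variable {𝔤 : Type*} [NormedAddCommGroup 𝔤] [NormedSpace ℝ 𝔤]

/-- In the chart at `x₀` the anchor is `d(G) ∘ d(J) ∘ ρ`, where `G ∘ J` is the chart. -/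
theorem HasSmoothChartInverse.contMDiff_anchor {J : M → D} (hG : HasSmoothChartInverse I J)
    (hJ : ContMDiff I 𝓘(ℝ, D) ∞ J) (B : D →L[ℝ] 𝔤 →L[ℝ] D)
    (ρ : ∀ x : M, Trivial M 𝔤 x →L[ℝ] TangentSpace I x)
    (hρ : ∀ (x : M) (ξ : 𝔤), derivAlong I J x (ρ x ξ) = B (J x) ξ) :
    ContMDiff (I.prod 𝓘(ℝ, 𝔤)) I.tangent ∞
      (fun v : TotalSpace 𝔤 (Trivial M 𝔤) => (⟨v.1, ρ v.1 v.2⟩ : TangentBundle I M)) := by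
  have : IsManifold I 1 M := IsManifold.of_le (n := ∞) (by simp)
  intro v₀
  obtain ⟨G, hGd, hGe⟩ := hG v₀.1
  have hproj : ContMDiff (I.prod 𝓘(ℝ, 𝔤)) I ∞ (fun v : TotalSpace 𝔤 (Trivial M 𝔤) => v.1) :=
    contMDiff_proj (Trivial M 𝔤)
  have hJp : ContMDiff (I.prod 𝓘(ℝ, 𝔤)) 𝓘(ℝ, D) ∞
    (fun v : TotalSpace 𝔤 (Trivial M 𝔤) => J v.1) := hJ.comp hproj
  refine contMDiffAt_totalSpace.2 ⟨hproj v₀, ?_⟩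
  have hD1 : ContMDiffAt (I.prod 𝓘(ℝ, 𝔤)) 𝓘(ℝ, D →L[ℝ] E₀) ∞
      (fun v : TotalSpace 𝔤 (Trivial M 𝔤) => fderiv ℝ G (J v.1)) v₀ :=
    ContMDiffAt.comp (g := fderiv ℝ G) (I' := 𝓘(ℝ, D)) v₀
      (hGd.fderiv_right (m := ∞) (by simp)).contMDiffAt (hJp v₀)
  have hB1 : ContMDiff (I.prod 𝓘(ℝ, 𝔤)) 𝓘(ℝ, 𝔤 →L[ℝ] D) ∞
      (fun v : TotalSpace 𝔤 (Trivial M 𝔤) => B (J v.1)) :=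
    B.contDiff.contMDiff.comp hJp
  have hB2 : ContMDiffAt (I.prod 𝓘(ℝ, 𝔤)) 𝓘(ℝ, D) ∞
      (fun v : TotalSpace 𝔤 (Trivial M 𝔤) => B (J v.1) v.2) v₀ :=
    (hB1 v₀).clm_apply (contMDiff_snd_trivial v₀)
  refine (hD1.clm_apply hB2).congr_of_eventuallyEq ?_
  have hev : ∀ᶠ x in nhds v₀.1, x ∈ (chartAt H₀ v₀.1).source ∧
      DifferentiableAt ℝ G (J x) ∧ (fun y => G (J y)) =ᶠ[nhds x] extChartAt I v₀.1 := by
    refine (Filter.eventually_mem_set.2 (chart_source_mem_nhds H₀ v₀.1)).and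
      (Filter.Eventually.and ?_ hGe.eventually_nhds)
    refine hJ.continuous.continuousAt.eventually ?_
    filter_upwards [(hGd.of_le (m := 1) (by simp)).eventually (by simp)] with y hy
    exact hy.differentiableAt (by simp)
  filter_upwards [hproj.continuous.continuousAt.eventually hev] with v hv
  obtain ⟨hv1, hv2, hv3⟩ := hv
  have h1 := DFunLike.congr_fun
    (TangentBundle.continuousLinearMapAt_trivializationAt (I := I) hv1) (ρ v.1 v.2)
  have hmem : v.1 ∈ (trivializationAt E₀ (TangentSpace I) v₀.1).baseSet := by
    rwa [TangentBundle.trivializationAt_baseSet]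
  rw [Trivialization.continuousLinearMapAt_apply_of_mem ℝ _ hmem] at h1
  refine h1.trans ?_
  rw [← hρ, ← derivAlong_comp hv2 (hJ.mdifferentiableAt (by simp))]
  unfold derivAlong
  rw [hv3.mfderiv_eq]
  rfl

/-- The bracket of the sections of `M × 𝔤` that extends a bracket `b` of `𝔤` by the Leibniz rule. -/
def actionBracket (I : ModelWithCorners ℝ E₀ H₀) (b : 𝔤 →L[ℝ] 𝔤 →L[ℝ] 𝔤)
    (ρ : ∀ x : M, Trivial M 𝔤 x →L[ℝ] TangentSpace I x) (σ τ : M → 𝔤) : M → 𝔤 := fun x =>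
  b (σ x) (τ x) + derivAlong I τ x (ρ x (σ x)) - derivAlong I σ x (ρ x (τ x))

/-- If the anchor is related by the immersion `J` to the coadjoint fields, then it is a homomorphism
of brackets: both sides of `ρ⟦σ, τ⟧ = [ρσ, ρτ]` have the same image under `dJ`, by the product rule
for `J ∘ ad σ` and the Jacobi identity. All other laws follow from this one and the calculus of
derivatives along vector fields. -/
theorem isLieAlgebroid_actionBracket [I.Boundaryless] [CompleteSpace E₀]
    {b : 𝔤 →L[ℝ] 𝔤 →L[ℝ] 𝔤} (hskew : ∀ ξ η, b ξ η = -b η ξ)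
    (hjac : ∀ ξ η θ, b ξ (b η θ) + b η (b θ ξ) + b θ (b ξ η) = 0)
    {J : M → StrongDual ℝ 𝔤} (hJ : ContMDiff I 𝓘(ℝ, StrongDual ℝ 𝔤) ∞ J)
    (hG : HasSmoothChartInverse I J) (ρ : ∀ x : M, Trivial M 𝔤 x →L[ℝ] TangentSpace I x)
    (hρ : ∀ (x : M) (ξ : 𝔤), derivAlong I J x (ρ x ξ) = coadjointField b (J x) ξ) :
    IsLieAlgebroid I 𝔤 (Trivial M 𝔤) (actionBracket I b ρ) ρ := by
  have hanchor := hG.contMDiff_anchor hJ (coadjointField b) ρ hρ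
  have hfield : ∀ {σ : M → 𝔤}, ContMDiff I 𝓘(ℝ, 𝔤) ∞ σ →
      ContMDiff I I.tangent ∞ (fun y => (⟨y, ρ y (σ y)⟩ : TangentBundle I M)) :=
    fun hσ => hanchor.comp (isSmoothSection_trivial_iff.2 hσ)
  have hderiv : ∀ {σ τ : M → 𝔤}, ContMDiff I 𝓘(ℝ, 𝔤) ∞ σ → ContMDiff I 𝓘(ℝ, 𝔤) ∞ τ →
      ContMDiff I 𝓘(ℝ, 𝔤) ∞ (fun y => derivAlong I τ y (ρ y (σ y))) :=
    fun hσ hτ => contMDiff_derivAlong hτ (hfield hσ)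
  have hb : ∀ {σ τ : M → 𝔤}, ContMDiff I 𝓘(ℝ, 𝔤) ∞ σ → ContMDiff I 𝓘(ℝ, 𝔤) ∞ τ →
      ContMDiff I 𝓘(ℝ, 𝔤) ∞ (fun y => b (σ y) (τ y)) :=
    fun hσ hτ => (b.contDiff.contMDiff.comp hσ).clm_apply hτ
  have hbr : ∀ {σ τ : M → 𝔤}, ContMDiff I 𝓘(ℝ, 𝔤) ∞ σ → ContMDiff I 𝓘(ℝ, 𝔤) ∞ τ →
      ContMDiff I 𝓘(ℝ, 𝔤) ∞ (actionBracket I b ρ σ τ) :=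
    fun hσ hτ => ((hb hσ hτ).add (hderiv hσ hτ)).sub (hderiv hτ hσ)
  have hmd : ∀ {σ : M → 𝔤}, ContMDiff I 𝓘(ℝ, 𝔤) ∞ σ → ∀ x, MDifferentiableAt I 𝓘(ℝ, 𝔤) σ x :=
    fun hσ x => hσ.mdifferentiableAt (by simp)
  have hJd : ∀ x, MDifferentiableAt I 𝓘(ℝ, StrongDual ℝ 𝔤) J x :=
    fun x => hJ.mdifferentiableAt (by simp)
  have hhom : ∀ {σ τ : M → 𝔤}, ContMDiff I 𝓘(ℝ, 𝔤) ∞ σ → ContMDiff I 𝓘(ℝ, 𝔤) ∞ τ → ∀ x,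
      ρ x (actionBracket I b ρ σ τ x) =
        VectorField.mlieBracket I (fun y => ρ y (σ y)) (fun y => ρ y (τ y)) x := by
    intro σ τ hσ hτ x
    apply hG.derivAlong_injective hJ x
    rw [derivAlong_mlieBracket hJ (hfield hσ) (hfield hτ), hρ]
    simp only [hρ]
    rw [derivAlong_bilin _ (hJd x) (hmd hτ x), derivAlong_bilin _ (hJd x) (hmd hσ x), hρ, hρ]
    ext θ
    have hj : b (b (σ x) (τ x)) θ = b (σ x) (b (τ x) θ) - b (τ x) (b (σ x) θ) := by
      rw [hskew (b (σ x) (τ x)) θ, hskew (σ x) θ, map_neg, sub_neg_eq_add, neg_eq_iff_add_eq_zero,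
        ← hjac (σ x) (τ x) θ]
      abel
    simp only [add_apply, sub_apply, coadjointField_apply, actionBracket, map_add, map_sub, hj]
    ring
  -- the derivative of a section along `ρ⟦σ, τ⟧` is a commutator of derivatives
  have hcomm : ∀ {σ τ υ : M → 𝔤}, ContMDiff I 𝓘(ℝ, 𝔤) ∞ σ → ContMDiff I 𝓘(ℝ, 𝔤) ∞ τ →
      ContMDiff I 𝓘(ℝ, 𝔤) ∞ υ → ∀ x, derivAlong I υ x (ρ x (actionBracket I b ρ σ τ x)) =
        derivAlong I (fun y => derivAlong I υ y (ρ y (τ y))) x (ρ x (σ x)) -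
          derivAlong I (fun y => derivAlong I υ y (ρ y (σ y))) x (ρ x (τ x)) := by
    intro σ τ υ hσ hτ hυ x
    rw [hhom hσ hτ, derivAlong_mlieBracket hυ (hfield hσ) (hfield hτ)]
  -- one term of the Jacobi identity, expanded so that the derivative terms of the cyclic sum cancel
  have hexp : ∀ {σ τ υ : M → 𝔤}, ContMDiff I 𝓘(ℝ, 𝔤) ∞ σ → ContMDiff I 𝓘(ℝ, 𝔤) ∞ τ →
      ContMDiff I 𝓘(ℝ, 𝔤) ∞ υ → ∀ x, actionBracket I b ρ σ (actionBracket I b ρ τ υ) x =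
        b (σ x) (b (τ x) (υ x)) + b (σ x) (derivAlong I υ x (ρ x (τ x))) -
        b (σ x) (derivAlong I τ x (ρ x (υ x))) - b (υ x) (derivAlong I τ x (ρ x (σ x))) +
        b (τ x) (derivAlong I υ x (ρ x (σ x))) +
        derivAlong I (fun y => derivAlong I υ y (ρ y (τ y))) x (ρ x (σ x)) -
        derivAlong I (fun y => derivAlong I τ y (ρ y (υ y))) x (ρ x (σ x)) -
        (derivAlong I (fun y => derivAlong I σ y (ρ y (υ y))) x (ρ x (τ x)) -
          derivAlong I (fun y => derivAlong I σ y (ρ y (τ y))) x (ρ x (υ x))) := by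
    intro σ τ υ hσ hτ hυ x
    rw [actionBracket, hcomm hτ hυ hσ]
    have h1 : derivAlong I (actionBracket I b ρ τ υ) x (ρ x (σ x)) =
        b (derivAlong I τ x (ρ x (σ x))) (υ x) + b (τ x) (derivAlong I υ x (ρ x (σ x))) +
        derivAlong I (fun y => derivAlong I υ y (ρ y (τ y))) x (ρ x (σ x)) -
        derivAlong I (fun y => derivAlong I τ y (ρ y (υ y))) x (ρ x (σ x)) := by
      rw [← derivAlong_bilin b (hmd hτ x) (hmd hυ x)]
      rw [← derivAlong_add (hmd (hb hτ hυ) x) (hmd (hderiv hτ hυ) x)]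
      exact derivAlong_sub (hmd ((hb hτ hυ).add (hderiv hτ hυ)) x) (hmd (hderiv hυ hτ) x) _
    rw [h1, hskew (derivAlong I τ x (ρ x (σ x))) (υ x)]
    simp only [actionBracket, map_add, map_sub]
    abel
  refine
    { smooth_bundle := inferInstance
      smooth_anchor := hanchor
      smooth_bracket := fun σ τ hσ hτ => isSmoothSection_trivial_iff.2
        (hbr (isSmoothSection_trivial_iff.1 hσ) (isSmoothSection_trivial_iff.1 hτ))
      bracket_add := fun σ τ υ hσ hτ hυ => ?_
      bracket_smul := fun c σ τ hσ hτ => ?_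
      bracket_skew := fun σ τ hσ hτ => ?_
      jacobi := fun σ τ υ hσ hτ hυ => ?_
      leibniz := fun f σ τ hf hσ hτ x => ?_
      anchor_bracket := fun σ τ hσ hτ x => hhom (isSmoothSection_trivial_iff.1 hσ)
        (isSmoothSection_trivial_iff.1 hτ) x }
  · have hτ' := hmd (isSmoothSection_trivial_iff.1 hτ)
    have hυ' := hmd (isSmoothSection_trivial_iff.1 hυ)
    funext x
    have h1 : derivAlong I (τ + υ : M → 𝔤) x (ρ x (σ x)) = _ := derivAlong_add (hτ' x) (hυ' x) _
    have h2 : ρ x (τ x + υ x) = ρ x (τ x) + ρ x (υ x) := map_add _ _ _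
    change b (σ x) (τ x + υ x) + derivAlong I (τ + υ : M → 𝔤) x (ρ x (σ x)) -
      derivAlong I σ x (ρ x (τ x + υ x)) = (b (σ x) (τ x) + derivAlong I τ x (ρ x (σ x)) -
      derivAlong I σ x (ρ x (τ x))) + (b (σ x) (υ x) + derivAlong I υ x (ρ x (σ x)) -
      derivAlong I σ x (ρ x (υ x)))
    rw [h1, h2, derivAlong_add_right, map_add]
    abel
  · have hτ' := hmd (isSmoothSection_trivial_iff.1 hτ)
    funext x
    have h1 : derivAlong I (c • τ : M → 𝔤) x (ρ x (σ x)) = _ := derivAlong_const_smul c (hτ' x) _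
    have h2 : ρ x (c • τ x) = c • ρ x (τ x) := map_smul _ _ _
    change b (σ x) (c • τ x) + derivAlong I (c • τ : M → 𝔤) x (ρ x (σ x)) -
      derivAlong I σ x (ρ x (c • τ x)) = c • (b (σ x) (τ x) + derivAlong I τ x (ρ x (σ x)) -
      derivAlong I σ x (ρ x (τ x)))
    rw [h1, h2, derivAlong_smul_right, map_smul, smul_sub, smul_add]
  · funext x
    change b (σ x) (τ x) + derivAlong I τ x (ρ x (σ x)) - derivAlong I σ x (ρ x (τ x)) =
      -(b (τ x) (σ x) + derivAlong I σ x (ρ x (τ x)) - derivAlong I τ x (ρ x (σ x)))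
    rw [hskew (σ x) (τ x)]
    abel
  · have hσ' := isSmoothSection_trivial_iff.1 hσ
    have hτ' := isSmoothSection_trivial_iff.1 hτ
    have hυ' := isSmoothSection_trivial_iff.1 hυ
    funext x
    change actionBracket I b ρ σ (actionBracket I b ρ τ υ) x +
      actionBracket I b ρ τ (actionBracket I b ρ υ σ) x +
      actionBracket I b ρ υ (actionBracket I b ρ σ τ) x = 0
    rw [hexp hσ' hτ' hυ', hexp hτ' hυ' hσ', hexp hυ' hσ' hτ']
    rw [← hjac (σ x) (τ x) (υ x)]
    abel
  · have hτ' := hmd (isSmoothSection_trivial_iff.1 hτ)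
    have hf' : MDifferentiableAt I 𝓘(ℝ, ℝ) f x := hf.mdifferentiableAt (by simp)
    have h1 : derivAlong I (fun y => f y • τ y : M → 𝔤) x (ρ x (σ x)) =
        derivAlong I f x (ρ x (σ x)) • τ x + f x • derivAlong I τ x (ρ x (σ x)) :=
      derivAlong_bilin (ContinuousLinearMap.lsmul ℝ ℝ) hf' (hτ' x) _
    have h2 : ρ x (f x • τ x) = f x • ρ x (τ x) := map_smul _ _ _
    change b (σ x) (f x • τ x) + derivAlong I (fun y => f y • τ y : M → 𝔤) x (ρ x (σ x)) -
      derivAlong I σ x (ρ x (f x • τ x)) = f x • (b (σ x) (τ x) + derivAlong I τ x (ρ x (σ x)) -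
      derivAlong I σ x (ρ x (τ x))) + derivAlong I f x (ρ x (σ x)) • τ x
    rw [h1, h2, derivAlong_smul_right, map_smul, smul_sub, smul_add]
    abel

end ActionAlgebroid

/-! ### The Heisenberg equation -/

section Heisenberg

variable {V : Type*} [NormedAddCommGroup V] [InnerProductSpace ℂ V] [CompleteSpace V]
  {E₀ : Type*} [NormedAddCommGroup E₀] [NormedSpace ℝ E₀]
  {H₀ : Type*} [TopologicalSpace H₀] {I : ModelWithCorners ℝ E₀ H₀}
  {M : Type*} [TopologicalSpace M] [ChartedSpace H₀ M]

theorem isHeisenbergAnchor_iff {ħ : ℝ} (hħ : ħ ≠ 0) {J : M → UnitaryDual V}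
    (hJ : ∀ x, MDifferentiableAt I 𝓘(ℝ, UnitaryDual V) J x)
    {ρ : ∀ x : M, Trivial M (UnitaryLie V) x →L[ℝ] TangentSpace I x} :
    IsHeisenbergAnchor I ħ J ρ ↔ ∀ (x : M) (ξ : UnitaryLie V),
      derivAlong I J x (ρ x ξ) = coadjointField (unitaryBracket V) (J x) ξ := by
  have h : ∀ (A : Observable V) (x : M) (v : TangentSpace I x),
      derivAlong I (fun y => observableHat A (J y)) x v =
        derivAlong I J x v (observableToLie A) := by
    intro A x v
    let L : UnitaryDual V →L[ℝ] ℝ := ContinuousLinearMap.apply ℝ ℝ (observableToLie A)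
    have h1 := derivAlong_comp (L.differentiableAt (x := J x)) (hJ x) v
    rw [L.fderiv] at h1
    exact h1
  constructor
  · intro hρ x ξ
    obtain ⟨H, rfl⟩ := (hamiltonianElement_bijective hħ).2 ξ
    ext a
    obtain ⟨A, rfl⟩ := observableToLie_surjective a
    rw [← observableHat_heisenbergRHS, ← hρ H A x, h]
  · intro hρ H A x
    rw [h, hρ, observableHat_heisenbergRHS]

theorem sectionBracket_eq_actionBracket
    (ρ : ∀ x : M, Trivial M (UnitaryLie V) x →L[ℝ] TangentSpace I x) :
    sectionBracket I ρ = actionBracket I (unitaryBracket V) ρ := rfl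

theorem existsUnique_isHeisenbergAnchor {ħ : ℝ} (hħ : ħ ≠ 0) {J : M → UnitaryDual V}
    (hJ : ∀ x, MDifferentiableAt I 𝓘(ℝ, UnitaryDual V) J x)
    (hinj : ∀ x, Function.Injective (derivAlong I J x))
    (hex : ∀ x, ∃ R : UnitaryLie V →L[ℝ] TangentSpace I x, ∀ ξ,
      derivAlong I J x (R ξ) = coadjointField (unitaryBracket V) (J x) ξ) :
    ∃! ρ, IsHeisenbergAnchor I ħ J ρ := by
  choose R hR using hex
  refine ⟨R, (isHeisenbergAnchor_iff hħ hJ).2 hR, fun ρ hρ => ?_⟩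
  funext x
  refine ContinuousLinearMap.ext fun ξ => hinj x ?_
  exact ((isHeisenbergAnchor_iff hħ hJ).1 hρ x ξ).trans (hR x ξ).symm

variable [IsManifold I ∞ M]

theorem isLieAlgebroid_of_isHeisenbergAnchor [I.Boundaryless] [CompleteSpace E₀] {ħ : ℝ}
    (hħ : ħ ≠ 0) {J : M → UnitaryDual V} (hJ : ContMDiff I 𝓘(ℝ, UnitaryDual V) ∞ J)
    (hG : HasSmoothChartInverse I J)
    {ρ : ∀ x : M, Trivial M (UnitaryLie V) x →L[ℝ] TangentSpace I x}
    (hρ : IsHeisenbergAnchor I ħ J ρ) :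
    IsLieAlgebroid I (UnitaryLie V) (Trivial M (UnitaryLie V)) (sectionBracket I ρ) ρ := by
  have h := (isHeisenbergAnchor_iff hħ fun x => hJ.mdifferentiableAt (by simp)).1 hρ
  rw [sectionBracket_eq_actionBracket]
  exact isLieAlgebroid_actionBracket (b := unitaryBracket V) unitaryBracket_skew
    unitaryBracket_jacobi hJ hG ρ h

end Heisenberg

section HeisenbergDual

variable {V : Type*} [NormedAddCommGroup V] [InnerProductSpace ℂ V] [CompleteSpace V]

theorem hasSmoothChartInverse_id {D : Type*} [NormedAddCommGroup D] [NormedSpace ℝ D] :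
    HasSmoothChartInverse 𝓘(ℝ, D) (id : D → D) := fun x₀ =>
  ⟨id, contDiffAt_id, Filter.Eventually.of_forall fun x => by
    simp only [extChartAt_model_space_eq_id, PartialEquiv.refl_coe, id]⟩

theorem derivAlong_id {D : Type*} [NormedAddCommGroup D] [NormedSpace ℝ D] (x v : D) :
    derivAlong 𝓘(ℝ, D) (id : D → D) x v = v := by
  unfold derivAlong
  rw [mfderiv_id]
  rfl

theorem existsUnique_isHeisenbergAnchor_id {ħ : ℝ} (hħ : ħ ≠ 0) :
    ∃! ρ, IsHeisenbergAnchor 𝓘(ℝ, UnitaryDual V) ħ (id : UnitaryDual V → UnitaryDual V) ρ :=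
  existsUnique_isHeisenbergAnchor hħ (fun _ => mdifferentiableAt_id)
    (fun x v w h => by
      have h' := h
      rwa [derivAlong_id x v, derivAlong_id x w] at h')
    (fun x => ⟨coadjointField (unitaryBracket V) x, fun ξ => derivAlong_id x _⟩)

theorem derivAlong_eq_liePoisson [FiniteDimensional ℂ V] {ħ : ℝ} (hħ : ħ ≠ 0)
    {ρ : ∀ x : UnitaryDual V,
      Trivial (UnitaryDual V) (UnitaryLie V) x →L[ℝ] TangentSpace 𝓘(ℝ, UnitaryDual V) x}
    (hρ : IsHeisenbergAnchor 𝓘(ℝ, UnitaryDual V) ħ (id : UnitaryDual V → UnitaryDual V) ρ)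
    (H : Observable V) (f : UnitaryDual V → ℝ) (ζ : UnitaryDual V) :
    derivAlong 𝓘(ℝ, UnitaryDual V) f ζ (ρ ζ (hamiltonianElement ħ H)) =
      ħ⁻¹ * liePoisson (observableHat H) f ζ := by
  have h := (isHeisenbergAnchor_iff hħ fun _ => mdifferentiableAt_id).1 hρ ζ
    (hamiltonianElement ħ H)
  have h1 : ρ ζ (hamiltonianElement ħ H) =
      coadjointField (unitaryBracket V) ζ (hamiltonianElement ħ H) :=
    (derivAlong_id ζ _).symm.trans h
  rw [h1, liePoisson_eq_linearPoisson, linearPoisson_eq_fderiv, gradientOnDual_observableHat,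
    hamiltonianElement, map_smul]
  have h2 : ∀ v : UnitaryDual V, derivAlong 𝓘(ℝ, UnitaryDual V) f ζ v = fderiv ℝ f ζ v := by
    intro v
    rw [← mfderiv_eq_fderiv]
    rfl
  rw [h2]
  exact map_smul (fderiv ℝ f ζ) _ _

end HeisenbergDual

/-! ### Smooth maps into and out of the projective space -/

section ProjectiveSpace

variable {V : Type*} [NormedAddCommGroup V] [InnerProductSpace ℂ V]
  {n : ℕ} [hn : Fact (Module.finrank ℂ V = n + 1)]

theorem affineChart_mk (i : Fin (n + 1)) (v : V) (hv : v ≠ 0) :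
    affineChart V i (Projectivization.mk ℂ v hv) = affineCoord i v :=
  affineCoord_rep_mk i v hv

theorem mk_mem_affineChart_source {i : Fin (n + 1)} {v : V} (hv : v ≠ 0) :
    Projectivization.mk ℂ v hv ∈ (affineChart V i).source ↔ stateCoord V n v i ≠ 0 :=
  stateCoord_rep_mk i v hv

theorem affineChart_symm_affineCoord {i : Fin (n + 1)} {v : V} (hv : v ≠ 0)
    (hi : stateCoord V n v i ≠ 0) :
    (affineChart V i).symm (affineCoord i v) = Projectivization.mk ℂ v hv := by
  rw [← affineChart_mk i v hv]
  exact (affineChart V i).left_inv ((mk_mem_affineChart_source hv).2 hi)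

theorem affineChart_symm_apply (i : Fin (n + 1)) (z : EuclideanSpace ℂ (Fin n)) :
    (affineChart V i).symm z = Projectivization.mk ℂ (affineVec V i z) (affineVec_ne_zero i z) :=
  rfl

theorem affineChart_mem_maximalAtlas (i : Fin (n + 1)) :
    affineChart V i ∈ IsManifold.maximalAtlas 𝓘(ℝ, EuclideanSpace ℂ (Fin n)) ∞ (ℙ ℂ V) :=
  IsManifold.subset_maximalAtlas (Set.mem_range_self i)

theorem contMDiff_affineChart_symm (i : Fin (n + 1)) :
    ContMDiff 𝓘(ℝ, EuclideanSpace ℂ (Fin n)) 𝓘(ℝ, EuclideanSpace ℂ (Fin n)) ∞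
      (affineChart V i).symm :=
  contMDiffOn_univ.1 (contMDiffOn_symm_of_mem_maximalAtlas (affineChart_mem_maximalAtlas i))

theorem contMDiffOn_affineChart (i : Fin (n + 1)) :
    ContMDiffOn 𝓘(ℝ, EuclideanSpace ℂ (Fin n)) 𝓘(ℝ, EuclideanSpace ℂ (Fin n)) ∞
      (affineChart V i) (affineChart V i).source :=
  contMDiffOn_of_mem_maximalAtlas (affineChart_mem_maximalAtlas i)

theorem contDiffAt_affineCoord {i : Fin (n + 1)} {v : V} (hi : stateCoord V n v i ≠ 0) :
    ContDiffAt ℝ ∞ (affineCoord (n := n) i) v :=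
  ((contDiffOn_affineCoord i).contDiffAt
    ((isOpen_ne.preimage (continuous_stateCoord i)).mem_nhds hi)).restrict_scalars ℝ

variable {E₁ : Type*} [NormedAddCommGroup E₁] [NormedSpace ℝ E₁]
  {H₁ : Type*} [TopologicalSpace H₁] {I' : ModelWithCorners ℝ E₁ H₁}
  {N : Type*} [TopologicalSpace N] [ChartedSpace H₁ N]

/-- The class of a smooth family of nonzero vectors is a smooth family of points. -/
theorem ContMDiff.projectivization_mk {f : N → V} (hf : ContMDiff I' 𝓘(ℝ, V) ∞ f)
    (h0 : ∀ x, f x ≠ 0) :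
    ContMDiff I' 𝓘(ℝ, EuclideanSpace ℂ (Fin n)) ∞
      (fun x => Projectivization.mk ℂ (f x) (h0 x)) := by
  intro x
  obtain ⟨i, hi⟩ := exists_mem_affineChart (n := n) (Projectivization.mk ℂ (f x) (h0 x))
  rw [mk_mem_affineChart_source] at hi
  have h1 : ContMDiffAt I' 𝓘(ℝ, EuclideanSpace ℂ (Fin n)) ∞
      (fun y => (affineChart V i).symm (affineCoord i (f y))) x :=
    (contMDiff_affineChart_symm i).contMDiffAt.comp x
      ((contDiffAt_affineCoord hi).contMDiffAt.comp x (hf x))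
  refine h1.congr_of_eventuallyEq ?_
  have ho : IsOpen {v : V | stateCoord V n v i ≠ 0} := isOpen_ne.preimage (continuous_stateCoord i)
  filter_upwards [hf.continuous.continuousAt.eventually (ho.mem_nhds hi)] with y hy
  exact (affineChart_symm_affineCoord (h0 y) hy).symm

/-- A function on the projective space is smooth if it is smooth in the standard affine
coordinates. -/
theorem contMDiff_of_affineVec {g : ℙ ℂ V → N}
    (hg : ∀ i : Fin (n + 1), ContMDiff 𝓘(ℝ, EuclideanSpace ℂ (Fin n)) I' ∞
      (fun z => g (Projectivization.mk ℂ (affineVec V i z) (affineVec_ne_zero i z)))) :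
    ContMDiff 𝓘(ℝ, EuclideanSpace ℂ (Fin n)) I' ∞ g := by
  intro p
  obtain ⟨i, hi⟩ := exists_mem_affineChart (n := n) p
  have ho := (affineChart V i).open_source.mem_nhds hi
  refine ((hg i).contMDiffAt.comp p
    ((contMDiffOn_affineChart i).contMDiffAt ho)).congr_of_eventuallyEq ?_
  filter_upwards [ho] with q hq
  exact congrArg g ((affineChart V i).left_inv hq).symm

end ProjectiveSpace

/-! ### The momentum map -/

section MomentumMap

variable {V : Type*} [NormedAddCommGroup V] [InnerProductSpace ℂ V] [CompleteSpace V]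

/-- The functional `ξ ↦ ⟨v|(-iξ)v⟩ / ⟨v|v⟩` on `𝔲(V)` given by the vector `v`. -/
def vectorMomentum (v : V) : UnitaryDual V :=
  (‖v‖ ^ 2)⁻¹ • (Complex.imCLM ∘L ((innerSL ℂ v).restrictScalars ℝ) ∘L
    ((ContinuousLinearMap.apply ℂ V v).restrictScalars ℝ) ∘L
    (skewAdjoint.submodule ℝ (V →L[ℂ] V)).subtypeL)

theorem vectorMomentum_apply (v : V) (ξ : UnitaryLie V) :
    vectorMomentum v ξ = (‖v‖ ^ 2)⁻¹ * (⟪v, ξ.1 v⟫_ℂ).im := rfl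

theorem vectorMomentum_smul {c : ℂ} (hc : c ≠ 0) (v : V) :
    vectorMomentum (c • v) = vectorMomentum v := by
  ext ξ
  have h : (starRingEnd ℂ) c * c = ((‖c‖ ^ 2 : ℝ) : ℂ) := by
    rw [mul_comm, Complex.mul_conj, Complex.normSq_eq_norm_sq]
  have hc' : ‖c‖ ≠ 0 := norm_ne_zero_iff.2 hc
  rw [vectorMomentum_apply, vectorMomentum_apply, map_smul, inner_smul_left, inner_smul_right,
    ← mul_assoc, h, Complex.im_ofReal_mul, norm_smul, mul_pow, mul_inv]
  field_simp

theorem momentumMap_mk (v : V) (hv : v ≠ 0) :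
    momentumMap (Projectivization.mk ℂ v hv) = vectorMomentum v := by
  obtain ⟨c, hc, h⟩ := rep_mk_coord v hv
  rw [← vectorMomentum_smul hc v, ← h]
  rfl

theorem UnitaryLie.inner_left (ξ : UnitaryLie V) (v w : V) : ⟪ξ.1 v, w⟫_ℂ = -⟪v, ξ.1 w⟫_ℂ := by
  have hξ : ContinuousLinearMap.adjoint ξ.1 = -ξ.1 := ξ.2
  rw [← ContinuousLinearMap.adjoint_inner_right, hξ, neg_apply, inner_neg_right]

theorem contDiff_inner_apply (ξ : UnitaryLie V) : ContDiff ℝ ∞ (fun v : V => (⟪v, ξ.1 v⟫_ℂ).im) :=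
  Complex.imCLM.contDiff.comp
    (contDiff_id.inner ℂ ((ξ.1.restrictScalars ℝ).contDiff))

theorem fderiv_clm_inner_apply {W : Type*} [NormedAddCommGroup W] [InnerProductSpace ℂ W]
    (L : ℂ →L[ℝ] ℝ) (S : W →L[ℂ] W) (v w : W) :
    fderiv ℝ (fun u : W => L (⟪u, S u⟫_ℂ)) v w = L (⟪v, S w⟫_ℂ + ⟪w, S v⟫_ℂ) := by
  have hid : HasFDerivAt (fun u : W => u) (ContinuousLinearMap.id ℝ W) v := hasFDerivAt_id v
  have hS : HasFDerivAt (fun u : W => S u) (S.restrictScalars ℝ) v :=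
    (S.restrictScalars ℝ).hasFDerivAt
  have h : HasFDerivAt (fun u : W => L (⟪u, S u⟫_ℂ)) _ v :=
    L.hasFDerivAt.comp v (hid.inner ℂ hS)
  rw [h.fderiv]
  rfl

/-- The velocity `-ξv` of the flow `exp (-tξ) v` of a skew-adjoint `ξ` realises the coadjoint field:
the flow preserves the norm, and on `⟨v|av⟩` it acts by the commutator `[ξ, a]`. -/
theorem fderiv_vectorMomentum_apply {v : V} (hv : v ≠ 0) (ξ a : UnitaryLie V) :
    fderiv ℝ (fun u : V => vectorMomentum u a) v (-(ξ.1 v)) =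
      coadjointField (unitaryBracket V) (vectorMomentum v) ξ a := by
  set w : V := -(ξ.1 v) with hw
  have hN : DifferentiableAt ℝ (fun u : V => ‖u‖ ^ 2) v :=
    (contDiff_norm_sq ℂ (n := 1)).differentiable (by simp) v
  have hN' : fderiv ℝ (fun u : V => ‖u‖ ^ 2) v w = 0 := by
    have h1 : (fun u : V => ‖u‖ ^ 2) =
        fun u => Complex.reCLM (⟪u, (1 : V →L[ℂ] V) u⟫_ℂ) :=
      funext fun u => (inner_self_eq_norm_sq (𝕜 := ℂ) u).symm
    rw [h1, fderiv_clm_inner_apply]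
    simp [hw, UnitaryLie.inner_left]
  have hq : DifferentiableAt ℝ (fun u : V => (⟪u, a.1 u⟫_ℂ).im) v :=
    (contDiff_inner_apply a).differentiable (by simp) v
  have hq' : fderiv ℝ (fun u : V => (⟪u, a.1 u⟫_ℂ).im) v w =
      (⟪v, (ξ.1 * a.1 - a.1 * ξ.1) v⟫_ℂ).im := by
    have h1 : (fun u : V => (⟪u, a.1 u⟫_ℂ).im) = fun u => Complex.imCLM (⟪u, a.1 u⟫_ℂ) := rfl
    rw [h1, fderiv_clm_inner_apply]
    simp [hw, UnitaryLie.inner_left]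
    ring
  have hv' : ‖v‖ ^ 2 ≠ 0 := pow_ne_zero 2 (norm_ne_zero_iff.2 hv)
  have hinv : HasFDerivAt (fun u : V => (‖u‖ ^ 2)⁻¹) _ v :=
    (hasDerivAt_inv hv').comp_hasFDerivAt v hN.hasFDerivAt
  have hmul : HasFDerivAt (fun u : V => (‖u‖ ^ 2)⁻¹ * (⟪u, a.1 u⟫_ℂ).im) _ v :=
    hinv.mul hq.hasFDerivAt
  simp only [vectorMomentum_apply]
  rw [hmul.fderiv, coadjointField_apply, vectorMomentum_apply]
  simp only [add_apply, smul_apply, smul_eq_mul, hN', hq']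
  rw [mul_zero, mul_zero, add_zero]
  rfl

section FiniteDimensional

variable [FiniteDimensional ℂ V]

theorem contDiffAt_vectorMomentum {v : V} (hv : v ≠ 0) :
    ContDiffAt ℝ ∞ (vectorMomentum : V → UnitaryDual V) v := by
  -- without its denominator the functional is quadratic in the vector
  have h1 : ContDiff ℝ ∞ (fun u : V => ‖u‖ ^ 2 • vectorMomentum u) := by
    rw [contDiff_clm_apply_iff]
    intro a
    have h : (fun u : V => (‖u‖ ^ 2 • vectorMomentum u) a) = fun u => (⟪u, a.1 u⟫_ℂ).im := by
      funext u
      change ‖u‖ ^ 2 * ((‖u‖ ^ 2)⁻¹ * (⟪u, a.1 u⟫_ℂ).im) = _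
      rcases eq_or_ne u 0 with rfl | hu
      · simp
      · exact mul_inv_cancel_left₀ (pow_ne_zero 2 (norm_ne_zero_iff.2 hu)) _
    rw [h]
    exact contDiff_inner_apply a
  have h2 : ContDiffAt ℝ ∞ (fun u : V => (‖u‖ ^ 2)⁻¹) v :=
    (contDiff_norm_sq ℂ).contDiffAt.inv (pow_ne_zero 2 (norm_ne_zero_iff.2 hv))
  refine (h2.smul h1.contDiffAt).congr_of_eventuallyEq ?_
  filter_upwards [isOpen_ne.mem_nhds hv] with u hu
  exact (inv_smul_smul₀ (pow_ne_zero 2 (norm_ne_zero_iff.2 hu)) _).symm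

theorem fderiv_vectorMomentum {v : V} (hv : v ≠ 0) (ξ : UnitaryLie V) :
    fderiv ℝ vectorMomentum v (-(ξ.1 v)) =
      coadjointField (unitaryBracket V) (vectorMomentum v) ξ := by
  ext a
  rw [← fderiv_vectorMomentum_apply hv]
  let L : UnitaryDual V →L[ℝ] ℝ := ContinuousLinearMap.apply ℝ ℝ a
  have h : HasFDerivAt (fun u : V => vectorMomentum u a) _ v :=
    L.hasFDerivAt.comp v ((contDiffAt_vectorMomentum hv).differentiableAt (by simp)).hasFDerivAt
  rw [h.fderiv]
  rfl

end FiniteDimensional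

/-! ### Recovering a point of the projective space from its momentum -/

/-- The skew-adjoint part `(T - T†) / 2` of an operator. -/
def skewPart (T : V →L[ℂ] V) : UnitaryLie V :=
  ⟨(2⁻¹ : ℝ) • (T - star T), by
    change star ((2⁻¹ : ℝ) • (T - star T)) = -((2⁻¹ : ℝ) • (T - star T))
    rw [star_smul, star_sub, star_star, ← smul_neg, neg_sub]
    rfl⟩

/-- The complex-linear extension `ζ ↦ ζ(T)` of functionals on `𝔲(V)` to all operators, normalised so
that it is the expectation value `⟨v|Tv⟩ / ⟨v|v⟩` at the momentum of `v`. -/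
def expectation (T : V →L[ℂ] V) (ζ : UnitaryDual V) : ℂ :=
  (ζ (skewPart T) : ℂ) * Complex.I - (ζ (skewPart (-(Complex.I • T))) : ℂ)

theorem vectorMomentum_skewPart (v : V) (T : V →L[ℂ] V) :
    vectorMomentum v (skewPart T) = (‖v‖ ^ 2)⁻¹ * (⟪v, T v⟫_ℂ).im := by
  rw [vectorMomentum_apply]
  have h : ⟪v, (skewPart T).1 v⟫_ℂ = (2⁻¹ : ℂ) * (⟪v, T v⟫_ℂ - (starRingEnd ℂ) ⟪v, T v⟫_ℂ) := by
    have h1 : (skewPart T).1 v = (2⁻¹ : ℝ) • (T v - ContinuousLinearMap.adjoint T v) := rfl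
    rw [h1, inner_smul_right_eq_smul, inner_sub_right, ContinuousLinearMap.adjoint_inner_right,
      inner_conj_symm, Complex.real_smul]
    norm_num
  rw [h]
  generalize ⟪v, T v⟫_ℂ = z
  congr 1
  simp
  ring

theorem expectation_vectorMomentum (T : V →L[ℂ] V) (v : V) :
    expectation T (vectorMomentum v) = ((‖v‖ ^ 2)⁻¹ : ℝ) * ⟪v, T v⟫_ℂ := by
  rw [expectation, vectorMomentum_skewPart, vectorMomentum_skewPart, neg_apply, inner_neg_right,
    smul_apply, inner_smul_right]
  generalize ⟪v, T v⟫_ℂ = z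
  generalize (‖v‖ ^ 2)⁻¹ = r
  apply Complex.ext <;> simp

theorem contDiff_expectation (T : V →L[ℂ] V) : ContDiff ℝ ∞ (expectation T) := by
  have h : ∀ a : UnitaryLie V, ContDiff ℝ ∞ (fun ζ : UnitaryDual V => (ζ a : ℂ)) := fun a =>
    Complex.ofRealCLM.contDiff.comp
      (ContinuousLinearMap.apply ℝ ℝ a : UnitaryDual V →L[ℝ] ℝ).contDiff
  exact ((h _).mul contDiff_const).sub (h _)

variable {n : ℕ} [hn : Fact (Module.finrank ℂ V = n + 1)]

variable (V) in
/-- The operator whose expectation value at a unit vector `v` is `conj (v_i) * v_j`. -/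
def coordOperator (i j : Fin (n + 1)) : V →L[ℂ] V :=
  ((EuclideanSpace.proj j).comp (stateCoord V n).toContinuousLinearMap :
    V →L[ℂ] ℂ).smulRight ((InnerProductSpace.toDual ℂ V).symm
      ((EuclideanSpace.proj i).comp (stateCoord V n).toContinuousLinearMap))

theorem inner_coordOperator (i j : Fin (n + 1)) (v : V) :
    ⟪v, coordOperator V i j v⟫_ℂ =
      (starRingEnd ℂ) (stateCoord V n v i) * stateCoord V n v j := by
  have h : coordOperator V i j v = stateCoord V n v j • (InnerProductSpace.toDual ℂ V).symm
      ((EuclideanSpace.proj i).comp (stateCoord V n).toContinuousLinearMap : V →L[ℂ] ℂ) := rfl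
  rw [h, inner_smul_right, ← inner_conj_symm, InnerProductSpace.toDual_symm_apply, mul_comm]
  rfl

variable (V) in
/-- A left inverse of the momentum map over the domain of the `i`-th affine chart, in the
coordinates of this chart. -/
def momentumCoord (i : Fin (n + 1)) (ζ : UnitaryDual V) : EuclideanSpace ℂ (Fin n) :=
  WithLp.toLp 2 fun j =>
    expectation (coordOperator V i (i.succAbove j)) ζ / expectation (coordOperator V i i) ζ

theorem expectation_coordOperator_ne_zero {i : Fin (n + 1)} {v : V} (hv : v ≠ 0) :
    expectation (coordOperator V i i) (vectorMomentum v) ≠ 0 ↔ stateCoord V n v i ≠ 0 := by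
  rw [expectation_vectorMomentum, inner_coordOperator]
  simp [hv]

theorem momentumCoord_vectorMomentum {i : Fin (n + 1)} {v : V} (hi : stateCoord V n v i ≠ 0) :
    momentumCoord V i (vectorMomentum v) = affineCoord i v := by
  have hv : v ≠ 0 := by
    rintro rfl
    simp at hi
  have hv' : ((‖v‖ ^ 2)⁻¹ : ℝ) ≠ 0 := inv_ne_zero (pow_ne_zero 2 (norm_ne_zero_iff.2 hv))
  ext j
  change expectation _ _ / expectation _ _ = stateCoord V n v (i.succAbove j) / stateCoord V n v i
  rw [expectation_vectorMomentum, expectation_vectorMomentum, inner_coordOperator,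
    inner_coordOperator, mul_div_mul_left _ _ (Complex.ofReal_ne_zero.2 hv'),
    mul_div_mul_left _ _ ((map_ne_zero _).2 hi)]

theorem contDiffAt_momentumCoord {i : Fin (n + 1)} {ζ : UnitaryDual V}
    (h : expectation (coordOperator V i i) ζ ≠ 0) : ContDiffAt ℝ ∞ (momentumCoord V i) ζ := by
  have h1 : ContDiffAt ℝ ∞ (fun (ζ : UnitaryDual V) (j : Fin n) =>
      expectation (coordOperator V i (i.succAbove j)) ζ / expectation (coordOperator V i i) ζ)
      ζ := by
    simp only [div_eq_mul_inv]
    exact contDiffAt_pi.2 fun j =>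
      (contDiff_expectation (coordOperator V i (i.succAbove j))).contDiffAt.mul
        ((contDiff_expectation (coordOperator V i i)).contDiffAt.inv h)
  have h2 : ContDiff ℝ ∞ (WithLp.toLp 2 : (Fin n → ℂ) → EuclideanSpace ℂ (Fin n)) :=
    ((PiLp.continuousLinearEquiv 2 ℂ
      fun _ : Fin n => ℂ).symm.toContinuousLinearMap.restrictScalars ℝ).contDiff
  exact h2.contDiffAt.comp ζ h1

theorem injective_momentumMap (n : ℕ) [Fact (Module.finrank ℂ V = n + 1)] :
    Function.Injective (momentumMap : ℙ ℂ V → UnitaryDual V) := by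
  intro p q h
  induction p using Projectivization.ind with | h v hv => ?_
  induction q using Projectivization.ind with | h w hw => ?_
  rw [momentumMap_mk, momentumMap_mk] at h
  obtain ⟨i, hi⟩ := exists_mem_affineChart (n := n) (Projectivization.mk ℂ v hv)
  rw [mk_mem_affineChart_source] at hi
  have hi' : stateCoord V n w i ≠ 0 := by
    rwa [← expectation_coordOperator_ne_zero hw, ← h, expectation_coordOperator_ne_zero hv]
  rw [← affineChart_symm_affineCoord hv hi, ← affineChart_symm_affineCoord hw hi',
    ← momentumCoord_vectorMomentum hi, ← momentumCoord_vectorMomentum hi', h]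

theorem hasSmoothChartInverse_momentumMap :
    HasSmoothChartInverse 𝓘(ℝ, EuclideanSpace ℂ (Fin n))
      (momentumMap : ℙ ℂ V → UnitaryDual V) := by
  intro p
  obtain ⟨i, hi⟩ : ∃ i : Fin (n + 1), chartAt (EuclideanSpace ℂ (Fin n)) p = affineChart V i :=
    ⟨_, rfl⟩
  have hp : p ∈ (affineChart V i).source := hi ▸ mem_chart_source _ p
  refine ⟨momentumCoord V i, contDiffAt_momentumCoord ?_, ?_⟩
  · exact (expectation_coordOperator_ne_zero p.rep_nonzero).2 hp
  · filter_upwards [(affineChart V i).open_source.mem_nhds hp] with q hq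
    rw [extChartAt, hi]
    exact momentumCoord_vectorMomentum hq

variable [FiniteDimensional ℂ V]

theorem contMDiff_momentumMap :
    ContMDiff 𝓘(ℝ, EuclideanSpace ℂ (Fin n)) 𝓘(ℝ, UnitaryDual V) ∞
      (momentumMap : ℙ ℂ V → UnitaryDual V) := by
  refine contMDiff_of_affineVec fun i => ?_
  simp only [momentumMap_mk]
  refine ContDiff.contMDiff (contDiff_iff_contDiffAt.2 fun z => ?_)
  exact (contDiffAt_vectorMomentum (affineVec_ne_zero i z)).comp z
    ((differentiable_affineVec i).contDiffAt.restrict_scalars ℝ)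

/-- The coadjoint fields are tangent to the image of the momentum map. -/
theorem exists_derivAlong_momentumMap (p : ℙ ℂ V) :
    ∃ R : UnitaryLie V →L[ℝ] TangentSpace 𝓘(ℝ, EuclideanSpace ℂ (Fin n)) p, ∀ ξ,
      derivAlong 𝓘(ℝ, EuclideanSpace ℂ (Fin n)) (momentumMap : ℙ ℂ V → UnitaryDual V) p (R ξ) =
        coadjointField (unitaryBracket V) (momentumMap p) ξ := by
  obtain ⟨i, hi⟩ := exists_mem_affineChart (n := n) p
  obtain ⟨v, hv, hvi, rfl⟩ : ∃ v : V, v ≠ 0 ∧ stateCoord V n v i ≠ 0 ∧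
      p = (affineChart V i).symm (affineCoord i v) :=
    ⟨p.rep, p.rep_nonzero, hi, ((affineChart V i).left_inv hi).symm⟩
  -- near `v` this is the projection `u ↦ [u]`, but it is defined on all of `V`
  let lift : V → ℙ ℂ V := fun u => (affineChart V i).symm (affineCoord i u)
  have hlift : MDifferentiableAt 𝓘(ℝ, V) 𝓘(ℝ, EuclideanSpace ℂ (Fin n)) lift v :=
    ((contMDiff_affineChart_symm i).contMDiffAt.comp v
      (contDiffAt_affineCoord hvi).contMDiffAt).mdifferentiableAt (by simp)
  let T : UnitaryLie V →L[ℝ] V := -(((ContinuousLinearMap.apply ℂ V v).restrictScalars ℝ) ∘L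
    (skewAdjoint.submodule ℝ (V →L[ℂ] V)).subtypeL)
  have hmom : MDifferentiableAt 𝓘(ℝ, EuclideanSpace ℂ (Fin n)) 𝓘(ℝ, UnitaryDual V)
      (momentumMap : ℙ ℂ V → UnitaryDual V) (lift v) :=
    contMDiff_momentumMap.mdifferentiableAt (by simp)
  have heq : momentumMap ∘ lift =ᶠ[nhds v] vectorMomentum := by
    have ho : IsOpen {u : V | stateCoord V n u i ≠ 0} :=
      isOpen_ne.preimage (continuous_stateCoord i)
    filter_upwards [ho.mem_nhds hvi, isOpen_ne.mem_nhds hv] with u hu hu0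
    change momentumMap ((affineChart V i).symm (affineCoord i u)) = _
    rw [affineChart_symm_affineCoord hu0 hu, momentumMap_mk]
  have hchain := mfderiv_comp v hmom hlift
  rw [heq.mfderiv_eq, mfderiv_eq_fderiv] at hchain
  refine ⟨(mfderiv 𝓘(ℝ, V) 𝓘(ℝ, EuclideanSpace ℂ (Fin n)) lift v).comp T, fun ξ => ?_⟩
  have h1 := fderiv_vectorMomentum hv ξ
  rw [hchain] at h1
  have h2 : momentumMap ((affineChart V i).symm (affineCoord i v)) = vectorMomentum v := by
    rw [affineChart_symm_affineCoord hv hvi, momentumMap_mk]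
  rw [h2]
  exact h1

end MomentumMap

/-! ### Smooth maps into and out of spheres -/

section Spheres

open Metric

/-- A map into the unit sphere is smooth at a point if it is smooth there as a map into the ambient
space: it is composed with the stereographic projection from the antipode of its value. -/
theorem contMDiffAt_sphere_of_coe {E : Type*} [NormedAddCommGroup E] [InnerProductSpace ℝ E] {n : ℕ}
    [Fact (Module.finrank ℝ E = n + 1)] {E₁ : Type*} [NormedAddCommGroup E₁] [NormedSpace ℝ E₁]
    {H₁ : Type*} [TopologicalSpace H₁] {I' : ModelWithCorners ℝ E₁ H₁}
    {N : Type*} [TopologicalSpace N] [ChartedSpace H₁ N] {f : N → sphere (0 : E) 1} {x : N}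
    (hf : ContMDiffAt I' 𝓘(ℝ, E) ∞ (fun y => (f y : E)) x) : ContMDiffAt I' (𝓡 n) ∞ f x := by
  rw [contMDiffAt_iff_target]
  refine ⟨Topology.IsInducing.subtypeVal.continuousAt_iff.2 hf.continuousAt, ?_⟩
  have hv : inner ℝ (-(f x : E)) (f x : E) ≠ (1 : ℝ) := by
    rw [inner_neg_left, real_inner_self_eq_norm_sq, norm_eq_of_mem_sphere]
    norm_num
  have ho : IsOpen {y : E | inner ℝ (-(f x : E)) y ≠ (1 : ℝ)} :=
    isOpen_ne.preimage (continuous_const.inner continuous_id)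
  have h1 : ContDiffAt ℝ ∞ (stereoToFun (-(f x : E))) (f x : E) :=
    (contDiffOn_stereoToFun (v := -(f x : E)) (n := ∞)).contDiffAt (ho.mem_nhds hv)
  let U := (OrthonormalBasis.fromOrthogonalSpanSingleton (𝕜 := ℝ) n
    (ne_zero_of_mem_unit_sphere (-(f x)))).repr
  have h2 : ContDiffAt ℝ ∞ (fun y => U (stereoToFun (-(f x : E)) y)) (f x : E) :=
    U.contDiff.contDiffAt.comp _ h1
  exact ContMDiffAt.comp (g := fun y => U (stereoToFun (-(f x : E)) y)) x h2.contMDiffAt hf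

variable {E₁ : Type*} [NormedAddCommGroup E₁] [NormedSpace ℝ E₁]
  {H₁ : Type*} [TopologicalSpace H₁] {I' : ModelWithCorners ℝ E₁ H₁}
  {N : Type*} [TopologicalSpace N] [ChartedSpace H₁ N]

theorem contMDiff_coe_circle : ContMDiff (𝓡 1) 𝓘(ℝ, ℂ) ∞ (fun c : Circle => (c : ℂ)) :=
  have : Fact (Module.finrank ℝ ℂ = 1 + 1) := finrank_real_complex_fact'
  contMDiff_coe_sphere (E := ℂ)

theorem contMDiffAt_circle_of_coe {f : N → Circle} {x : N}
    (hf : ContMDiffAt I' 𝓘(ℝ, ℂ) ∞ (fun y => (f y : ℂ)) x) : ContMDiffAt I' (𝓡 1) ∞ f x :=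
  have : Fact (Module.finrank ℝ ℂ = 1 + 1) := finrank_real_complex_fact'
  contMDiffAt_sphere_of_coe (E := ℂ) hf

variable {V : Type*} [NormedAddCommGroup V] [InnerProductSpace ℂ V]
  {n : ℕ} [hn : Fact (Module.finrank ℂ V = n + 1)]

theorem contMDiff_coe_stateSphere :
    ContMDiff (𝓡 (2 * n + 1)) 𝓘(ℝ, V) ∞ (fun ψ : sphere (0 : V) 1 => (ψ : V)) :=
  letI : InnerProductSpace ℝ V := InnerProductSpace.complexToReal
  contMDiff_coe_sphere (E := V)

theorem contMDiffAt_stateSphere_of_coe {f : N → sphere (0 : V) 1} {x : N}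
    (hf : ContMDiffAt I' 𝓘(ℝ, V) ∞ (fun y => (f y : V)) x) :
    ContMDiffAt I' (𝓡 (2 * n + 1)) ∞ f x :=
  letI : InnerProductSpace ℝ V := InnerProductSpace.complexToReal
  contMDiffAt_sphere_of_coe (E := V) hf

end Spheres

/-! ### The principal bundle of phases -/

section PhaseBundle

open Metric

/-- The phase `z / |z|` of a complex number; it is `1` at `z = 0`. -/
def phase (z : ℂ) : Circle := Circle.exp z.arg

theorem coe_phase {z : ℂ} (hz : z ≠ 0) : (phase z : ℂ) = (‖z‖⁻¹ : ℝ) • z := by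
  have h : (‖z‖ : ℂ) ≠ 0 := Complex.ofReal_ne_zero.2 (norm_ne_zero_iff.2 hz)
  have h1 := Complex.norm_mul_exp_arg_mul_I z
  rw [phase, Circle.coe_exp, Complex.real_smul, Complex.ofReal_inv]
  conv_rhs => rw [← h1]
  rw [Complex.norm_mul, Complex.norm_exp_ofReal_mul_I, mul_one, Complex.norm_real, norm_norm,
    inv_mul_cancel_left₀ h]

theorem phase_smul (c : Circle) {z : ℂ} (hz : z ≠ 0) : phase ((c : ℂ) * z) = c * phase z := by
  apply Circle.ext
  rw [Circle.coe_mul, coe_phase hz, coe_phase (mul_ne_zero c.coe_ne_zero hz), norm_mul,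
    Circle.norm_coe, one_mul, mul_smul_comm]

theorem contMDiffAt_phase {z : ℂ} (hz : z ≠ 0) : ContMDiffAt 𝓘(ℝ, ℂ) (𝓡 1) ∞ phase z := by
  apply contMDiffAt_circle_of_coe
  refine ContDiffAt.contMDiffAt ?_
  have h : ContDiffAt ℝ ∞ (fun z : ℂ => (‖z‖⁻¹ : ℝ) • z) z :=
    ((contDiffAt_norm ℂ hz).inv (norm_ne_zero_iff.2 hz)).smul contDiffAt_id
  refine h.congr_of_eventuallyEq ?_
  filter_upwards [isOpen_ne.mem_nhds hz] with w hw
  exact coe_phase hw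

variable {V : Type*} [NormedAddCommGroup V] [InnerProductSpace ℂ V]

theorem coe_circle_smul (c : Circle) (ψ : sphere (0 : V) 1) :
    ((c • ψ : sphere (0 : V) 1) : V) = (c : ℂ) • (ψ : V) := rfl

theorem sphereProj_smul (c : Circle) (ψ : sphere (0 : V) 1) :
    sphereProj (c • ψ) = sphereProj ψ :=
  (Projectivization.mk_eq_mk_iff' _ _ _ _ _).2 ⟨(c : ℂ), rfl⟩

theorem norm_smul_normalize {v : V} (hv : v ≠ 0) (c : Circle) :
    ‖(c : ℂ) • (‖v‖⁻¹ : ℝ) • v‖ = 1 := by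
  rw [norm_smul, norm_smul, Circle.norm_coe, norm_inv, norm_norm, one_mul,
    inv_mul_cancel₀ (norm_ne_zero_iff.2 hv)]

theorem surjective_sphereProj :
    Function.Surjective (sphereProj : sphere (0 : V) 1 → ℙ ℂ V) := by
  intro p
  induction p using Projectivization.ind with | h v hv => ?_
  refine ⟨⟨(‖v‖⁻¹ : ℝ) • v, by simpa using norm_smul_normalize hv 1⟩, ?_⟩
  exact (Projectivization.mk_eq_mk_iff' _ _ _ _ _).2 ⟨((‖v‖⁻¹ : ℝ) : ℂ), rfl⟩

theorem sphereProj_eq_mk_iff (ψ : V) (hψ : ψ ≠ 0) (φ : sphere (0 : V) 1) :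
    sphereProj φ = Projectivization.mk ℂ ψ hψ ↔
      ∃ θ : ℝ, (φ : V) = (Complex.exp (Complex.I * θ) / (‖ψ‖ : ℂ)) • ψ := by
  rw [sphereProj, Projectivization.mk_eq_mk_iff']
  constructor
  · rintro ⟨a, ha⟩
    have h1 : ‖a‖ * ‖ψ‖ = 1 := by
      rw [← norm_smul, ha, norm_eq_of_mem_sphere]
    refine ⟨a.arg, ?_⟩
    have h2 : (‖a‖ : ℂ) * (‖ψ‖ : ℂ) = 1 := by exact_mod_cast h1
    have h3 : Complex.exp (Complex.I * a.arg) / (‖ψ‖ : ℂ) = a := by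
      rw [div_eq_mul_inv, ← eq_inv_of_mul_eq_one_left h2, mul_comm, mul_comm Complex.I,
        Complex.norm_mul_exp_arg_mul_I]
    rw [h3, ha]
  · rintro ⟨θ, hθ⟩
    exact ⟨_, hθ.symm⟩

variable {n : ℕ} [hn : Fact (Module.finrank ℂ V = n + 1)]

theorem contMDiff_circle_smul :
    ContMDiff ((𝓡 1).prod (𝓡 (2 * n + 1))) (𝓡 (2 * n + 1)) ∞
      (fun x : Circle × sphere (0 : V) 1 => x.1 • x.2) := fun x =>
  contMDiffAt_stateSphere_of_coe
    ((contDiff_smul (𝕜 := ℝ) (𝕜' := ℂ) (F := V)).contMDiff.comp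
      ((contMDiff_coe_circle.comp contMDiff_fst).prodMk_space
        (contMDiff_coe_stateSphere.comp contMDiff_snd)) x)

theorem contMDiff_sphereProj :
    ContMDiff (𝓡 (2 * n + 1)) 𝓘(ℝ, EuclideanSpace ℂ (Fin n)) ∞
      (sphereProj : sphere (0 : V) 1 → ℙ ℂ V) :=
  contMDiff_coe_stateSphere.projectivization_mk fun ψ => ne_zero_of_mem_unit_sphere ψ

variable (V) in
/-- The unit vector over the point `p` with phase `c` in the `i`-th homogeneous coordinate. -/
def phaseSection (i : Fin (n + 1)) (x : ℙ ℂ V × Circle) : sphere (0 : V) 1 :=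
  ⟨(x.2 : ℂ) • (‖affineVec V i (affineChart V i x.1)‖⁻¹ : ℝ) •
      affineVec V i (affineChart V i x.1),
    by simpa using norm_smul_normalize (affineVec_ne_zero i (affineChart V i x.1)) x.2⟩

theorem coe_phaseSection (i : Fin (n + 1)) (p : ℙ ℂ V) (c : Circle) :
    (phaseSection V i (p, c) : V) = ((c : ℂ) * ((‖affineVec V i (affineChart V i p)‖⁻¹ : ℝ) : ℂ)) •
      affineVec V i (affineChart V i p) := by
  rw [mul_smul]
  rfl

theorem stateCoord_phaseSection (i : Fin (n + 1)) (p : ℙ ℂ V) (c : Circle) :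
    stateCoord V n (phaseSection V i (p, c) : V) i =
      (c : ℂ) * ((‖affineVec V i (affineChart V i p)‖⁻¹ : ℝ) : ℂ) := by
  rw [coe_phaseSection, map_smul, PiLp.smul_apply, stateCoord_affineVec]
  simp

theorem sphereProj_phaseSection {i : Fin (n + 1)} {p : ℙ ℂ V} (hp : p ∈ (affineChart V i).source)
    (c : Circle) : sphereProj (phaseSection V i (p, c)) = p := by
  conv_rhs => rw [← (affineChart V i).left_inv hp, affineChart_symm_apply]
  exact (Projectivization.mk_eq_mk_iff' _ _ _ _ _).2 ⟨_, (coe_phaseSection i p c).symm⟩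

theorem phase_stateCoord_phaseSection (i : Fin (n + 1)) (p : ℙ ℂ V) (c : Circle) :
    phase (stateCoord V n (phaseSection V i (p, c) : V) i) = c := by
  have hpos : 0 < ‖affineVec V i (affineChart V i p)‖⁻¹ :=
    inv_pos.2 (norm_pos_iff.2 (affineVec_ne_zero i _))
  rw [stateCoord_phaseSection, phase_smul c (Complex.ofReal_ne_zero.2 hpos.ne'), phase,
    Complex.arg_ofReal_of_nonneg hpos.le, Circle.exp_zero, mul_one]

theorem phaseSection_sphereProj {i : Fin (n + 1)} {ψ : sphere (0 : V) 1}
    (hψ : stateCoord V n (ψ : V) i ≠ 0) :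
    phaseSection V i (sphereProj ψ, phase (stateCoord V n (ψ : V) i)) = ψ := by
  apply Subtype.ext
  rw [coe_phaseSection, sphereProj, affineChart_mk, coe_phase hψ]
  have h := smul_affineVec_affineCoord i (ψ : V) hψ
  have hn : ‖stateCoord V n (ψ : V) i‖ * ‖affineVec V i (affineCoord i (ψ : V))‖ = 1 := by
    rw [← norm_smul, h, norm_eq_of_mem_sphere]
  conv_rhs => rw [← h]
  congr 1
  rw [← eq_inv_of_mul_eq_one_left hn, Complex.real_smul, mul_right_comm, ← Complex.ofReal_mul,
    inv_mul_cancel₀ (norm_ne_zero_iff.2 hψ), Complex.ofReal_one, one_mul]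

theorem contMDiffOn_phaseSection (i : Fin (n + 1)) :
    ContMDiffOn (𝓘(ℝ, EuclideanSpace ℂ (Fin n)).prod (𝓡 1)) (𝓡 (2 * n + 1)) ∞
      (phaseSection V i) ((affineChart V i).source ×ˢ Set.univ) := by
  intro x hx
  refine (contMDiffAt_stateSphere_of_coe ?_).contMDiffWithinAt
  have h1 : ContDiff ℝ ∞ (affineVec V (n := n) i) := (differentiable_affineVec i).restrict_scalars ℝ
  have h0 : ContDiff ℝ ∞ (fun z => (‖affineVec V (n := n) i z‖⁻¹ : ℝ)) :=
    (h1.norm ℂ (affineVec_ne_zero i)).inv fun z => norm_ne_zero_iff.2 (affineVec_ne_zero i z)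
  have h2 : ContDiff ℝ ∞ (fun z => (‖affineVec V (n := n) i z‖⁻¹ : ℝ) • affineVec V i z) :=
    (contDiff_smul (𝕜 := ℝ) (𝕜' := ℝ) (F := V)).comp (h0.prodMk h1)
  have h3 := ((contMDiffOn_affineChart i).contMDiffAt
    ((affineChart V i).open_source.mem_nhds hx.1)).comp x
    (contMDiffAt_fst (I := 𝓘(ℝ, EuclideanSpace ℂ (Fin n))) (J := 𝓡 1))
  have h4 := (contMDiff_coe_circle x.2).comp x
    (contMDiffAt_snd (I := 𝓘(ℝ, EuclideanSpace ℂ (Fin n))) (J := 𝓡 1))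
  exact (contDiff_smul (𝕜 := ℝ) (𝕜' := ℂ) (F := V)).contMDiff.contMDiffAt.comp x
    (h4.prodMk_space (h2.contMDiff.contMDiffAt.comp x h3))

theorem contMDiffOn_sphereProj_phase (i : Fin (n + 1)) :
    ContMDiffOn (𝓡 (2 * n + 1)) (𝓘(ℝ, EuclideanSpace ℂ (Fin n)).prod (𝓡 1)) ∞
      (fun ψ : sphere (0 : V) 1 => (sphereProj ψ, phase (stateCoord V n (ψ : V) i)))
      (sphereProj ⁻¹' (affineChart V i).source) := by
  intro ψ hψ
  have hi : stateCoord V n (ψ : V) i ≠ 0 := (mk_mem_affineChart_source _).1 hψ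
  have h1 : ContDiff ℝ ∞ (fun v : V => stateCoord V n v i) :=
    ((EuclideanSpace.proj (𝕜 := ℂ) i).contDiff.comp (stateCoord V n).contDiff).restrict_scalars ℝ
  have h2 : ContMDiffAt (𝓡 (2 * n + 1)) 𝓘(ℝ, ℂ) ∞
      (fun ψ : sphere (0 : V) 1 => stateCoord V n (ψ : V) i) ψ :=
    h1.contMDiff.contMDiffAt.comp ψ (contMDiff_coe_stateSphere (n := n) ψ)
  have h3 := ContMDiffAt.comp (g := phase) ψ (contMDiffAt_phase hi) h2
  exact ((contMDiff_sphereProj (n := n) ψ).prodMk h3).contMDiffWithinAt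

variable (V) in
/-- The trivialisation `ψ ↦ ([ψ], ψ_i / |ψ_i|)` of the bundle of phases over the domain of the
`i`-th affine chart. -/
def phaseTrivialization (i : Fin (n + 1)) :
    OpenPartialHomeomorph (sphere (0 : V) 1) (ℙ ℂ V × Circle) where
  toFun ψ := (sphereProj ψ, phase (stateCoord V n (ψ : V) i))
  invFun := phaseSection V i
  source := sphereProj ⁻¹' (affineChart V i).source
  target := (affineChart V i).source ×ˢ Set.univ
  map_source' _ hψ := ⟨hψ, Set.mem_univ _⟩
  map_target' x hx := by
    rw [Set.mem_preimage, sphereProj_phaseSection hx.1]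
    exact hx.1
  left_inv' _ hψ := phaseSection_sphereProj ((mk_mem_affineChart_source _).1 hψ)
  right_inv' x hx :=
    Prod.ext (sphereProj_phaseSection hx.1 x.2) (phase_stateCoord_phaseSection i x.1 x.2)
  open_source := (affineChart V i).open_source.preimage
    (contMDiff_sphereProj (n := n)).continuous
  open_target := (affineChart V i).open_source.prod isOpen_univ
  continuousOn_toFun := (contMDiffOn_sphereProj_phase i).continuousOn
  continuousOn_invFun := (contMDiffOn_phaseSection i).continuousOn

theorem isPrincipalBundle_sphereProj :
    IsPrincipalBundle (𝓡 1) (𝓡 (2 * n + 1)) 𝓘(ℝ, EuclideanSpace ℂ (Fin n)) Circle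
      (sphereProj : sphere (0 : V) 1 → ℙ ℂ V) where
  smooth_action := contMDiff_circle_smul
  smooth_proj := contMDiff_sphereProj
  surjective_proj := surjective_sphereProj
  proj_smul := sphereProj_smul
  locally_trivial p := by
    obtain ⟨i, hi⟩ := exists_mem_affineChart (n := n) p
    refine ⟨(affineChart V i).source, phaseTrivialization V i, (affineChart V i).open_source, hi,
      rfl, rfl, contMDiffOn_sphereProj_phase i, contMDiffOn_phaseSection i,
      fun ψ hψ => ⟨rfl, fun c => ?_⟩⟩
    have h : stateCoord V n ((c • ψ : sphere (0 : V) 1) : V) i =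
        (c : ℂ) * stateCoord V n (ψ : V) i := by
      rw [coe_circle_smul, map_smul, PiLp.smul_apply, smul_eq_mul]
    change phase (stateCoord V n ((c • ψ : sphere (0 : V) 1) : V) i) = _
    rw [h, phase_smul c ((mk_mem_affineChart_source _).1 hψ)]
    rfl

end PhaseBundle

/-! ### The coadjoint orbit of a pure state -/

section CoadjointOrbit

variable {V : Type*} [NormedAddCommGroup V] [InnerProductSpace ℂ V] [CompleteSpace V]

theorem vectorMomentum_unitary (U : unitary (V →L[ℂ] V)) (v : V) (ξ : UnitaryLie V) :
    vectorMomentum (U.1 v) ξ = vectorMomentum v (unitaryAd U⁻¹ ξ) := by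
  have hnorm : ‖U.1 v‖ = ‖v‖ := (Unitary.linearIsometryEquiv U).norm_map v
  have h1 : (unitaryAd U⁻¹ ξ).1 v = ContinuousLinearMap.adjoint U.1 (ξ.1 (U.1 v)) := by
    change (star U.1 * ξ.1 * star (star U.1)) v = _
    rw [star_star]
    rfl
  rw [vectorMomentum_apply, vectorMomentum_apply, hnorm, h1,
    ContinuousLinearMap.adjoint_inner_right]

variable [FiniteDimensional ℂ V]

/-- The unitary group acts transitively on the unit sphere: a unit vector is the first vector of an
orthonormal basis. -/
theorem exists_unitary_apply_eq {v w : V} (hv : ‖v‖ = 1) (hw : ‖w‖ = 1) :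
    ∃ U : unitary (V →L[ℂ] V), U.1 v = w := by
  have hpos : 0 < Module.finrank ℂ V :=
    Module.finrank_pos_iff_exists_ne_zero.2 ⟨v, norm_ne_zero_iff.1 (by rw [hv]; exact one_ne_zero)⟩
  let k : Fin (Module.finrank ℂ V) := ⟨0, hpos⟩
  have hb : ∀ u : V, ‖u‖ = 1 →
      ∃ b : OrthonormalBasis (Fin (Module.finrank ℂ V)) ℂ V, b k = u := by
    intro u hu
    have ho : Orthonormal ℂ (({k} : Set (Fin (Module.finrank ℂ V))).domRestrict fun _ => u) := by
      refine ⟨fun _ => hu, fun i j hij => (hij ?_).elim⟩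
      exact Subsingleton.elim i j
    obtain ⟨b, hb⟩ := ho.exists_orthonormalBasis_extension_of_card_eq (by simp)
    exact ⟨b, hb k rfl⟩
  obtain ⟨b, hbv⟩ := hb v hv
  obtain ⟨b', hbw⟩ := hb w hw
  refine ⟨Unitary.linearIsometryEquiv.symm (b.equiv b' (Equiv.refl _)), ?_⟩
  change (b.equiv b' (Equiv.refl _)) v = w
  rw [← hbv, OrthonormalBasis.equiv_apply_basis, ← hbw]
  rfl

theorem range_momentumMap (p : ℙ ℂ V) :
    Set.range (momentumMap : ℙ ℂ V → UnitaryDual V) = coadjointOrbit (momentumMap p) := by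
  induction p using Projectivization.ind with | h v hv => ?_
  rw [momentumMap_mk]
  ext η
  constructor
  · rintro ⟨q, rfl⟩
    induction q using Projectivization.ind with | h w hw => ?_
    have hnv : ((‖v‖⁻¹ : ℝ) : ℂ) ≠ 0 :=
      Complex.ofReal_ne_zero.2 (inv_ne_zero (norm_ne_zero_iff.2 hv))
    have hnw : ((‖w‖⁻¹ : ℝ) : ℂ) ≠ 0 :=
      Complex.ofReal_ne_zero.2 (inv_ne_zero (norm_ne_zero_iff.2 hw))
    have hunit : ∀ u : V, u ≠ 0 → ‖((‖u‖⁻¹ : ℝ) : ℂ) • u‖ = 1 := fun u hu => by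
      rw [norm_smul, Complex.norm_real, norm_inv, norm_norm,
        inv_mul_cancel₀ (norm_ne_zero_iff.2 hu)]
    obtain ⟨U, hU⟩ := exists_unitary_apply_eq (hunit v hv) (hunit w hw)
    refine ⟨U, fun ξ => ?_⟩
    rw [momentumMap_mk, ← vectorMomentum_smul hnw, ← hU, vectorMomentum_unitary,
      vectorMomentum_smul hnv]
  · rintro ⟨U, hU⟩
    have hUv : U.1 v ≠ 0 := by
      rw [← norm_ne_zero_iff, show ‖U.1 v‖ = ‖v‖ from (Unitary.linearIsometryEquiv U).norm_map v]
      exact norm_ne_zero_iff.2 hv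
    refine ⟨Projectivization.mk ℂ (U.1 v) hUv, ?_⟩
    ext ξ
    rw [momentumMap_mk, vectorMomentum_unitary, hU]

end CoadjointOrbit

/-! ### The two Lie algebroids of the Heisenberg equation -/

section HeisenbergAlgebroids

variable {V : Type*} [NormedAddCommGroup V] [InnerProductSpace ℂ V] [CompleteSpace V]

theorem isLieAlgebroid_dual {ħ : ℝ} (hħ : ħ ≠ 0)
    {ρ : ∀ x : UnitaryDual V,
      Trivial (UnitaryDual V) (UnitaryLie V) x →L[ℝ] TangentSpace 𝓘(ℝ, UnitaryDual V) x}
    (hρ : IsHeisenbergAnchor 𝓘(ℝ, UnitaryDual V) ħ (id : UnitaryDual V → UnitaryDual V) ρ) :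
    IsLieAlgebroid 𝓘(ℝ, UnitaryDual V) (UnitaryLie V)
      (Trivial (UnitaryDual V) (UnitaryLie V)) (sectionBracket 𝓘(ℝ, UnitaryDual V) ρ) ρ := by
  have h1 : ContMDiff 𝓘(ℝ, UnitaryDual V) 𝓘(ℝ, UnitaryDual V) ∞
    (id : UnitaryDual V → UnitaryDual V) := contMDiff_id
  have h2 : HasSmoothChartInverse 𝓘(ℝ, UnitaryDual V) (id : UnitaryDual V → UnitaryDual V) :=
    hasSmoothChartInverse_id
  exact isLieAlgebroid_of_isHeisenbergAnchor (J := id) hħ h1 h2 hρ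

variable [FiniteDimensional ℂ V] {n : ℕ} [hn : Fact (Module.finrank ℂ V = n + 1)]

theorem existsUnique_isHeisenbergAnchor_momentumMap {ħ : ℝ} (hħ : ħ ≠ 0) :
    ∃! ρ, IsHeisenbergAnchor 𝓘(ℝ, EuclideanSpace ℂ (Fin n)) ħ
      (momentumMap : ℙ ℂ V → UnitaryDual V) ρ :=
  existsUnique_isHeisenbergAnchor hħ (fun _ => contMDiff_momentumMap.mdifferentiableAt (by simp))
    (hasSmoothChartInverse_momentumMap.derivAlong_injective contMDiff_momentumMap)
    exists_derivAlong_momentumMap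

theorem isLieAlgebroid_projectivization {ħ : ℝ} (hħ : ħ ≠ 0)
    {ρ : ∀ p : ℙ ℂ V,
      Trivial (ℙ ℂ V) (UnitaryLie V) p →L[ℝ] TangentSpace 𝓘(ℝ, EuclideanSpace ℂ (Fin n)) p}
    (hρ : IsHeisenbergAnchor 𝓘(ℝ, EuclideanSpace ℂ (Fin n)) ħ
      (momentumMap : ℙ ℂ V → UnitaryDual V) ρ) :
    IsLieAlgebroid 𝓘(ℝ, EuclideanSpace ℂ (Fin n)) (UnitaryLie V) (Trivial (ℙ ℂ V) (UnitaryLie V))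
      (sectionBracket 𝓘(ℝ, EuclideanSpace ℂ (Fin n)) ρ) ρ :=
  isLieAlgebroid_of_isHeisenbergAnchor hħ contMDiff_momentumMap hasSmoothChartInverse_momentumMap hρ

end HeisenbergAlgebroids

end

theorem mainTheorem3 (n : ℕ) (V : Type*) [NormedAddCommGroup V] [InnerProductSpace ℂ V]
    [CompleteSpace V] [FiniteDimensional ℂ V] [Fact (Module.finrank ℂ V = n + 1)]
    (ħ : ℝ) (hħ : 0 < ħ) :
    -- the quantum phase space: the principal bundle of phases over the projective space
    (IsPrincipalBundle (𝓡 1) (𝓡 (2 * n + 1)) 𝓘(ℝ, EuclideanSpace ℂ (Fin n)) Circle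
        (sphereProj : Metric.sphere (0 : V) 1 → ℙ ℂ V) ∧
      ∀ (ψ : V) (hψ : ψ ≠ 0) (φ : Metric.sphere (0 : V) 1),
        sphereProj φ = Projectivization.mk ℂ ψ hψ ↔
          ∃ θ : ℝ, (φ : V) = (Complex.exp (Complex.I * θ) / (‖ψ‖ : ℂ)) • ψ) ∧
    -- the momentum map identifies it with an orbit of the unitary group in `𝔲(V)*`
    (ContMDiff 𝓘(ℝ, EuclideanSpace ℂ (Fin n)) 𝓘(ℝ, UnitaryDual V) ∞
        (momentumMap : ℙ ℂ V → UnitaryDual V) ∧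
      Function.Injective (momentumMap : ℙ ℂ V → UnitaryDual V) ∧
      ∀ p : ℙ ℂ V, Set.range (momentumMap : ℙ ℂ V → UnitaryDual V) =
        coadjointOrbit (momentumMap p)) ∧
    -- the Hamiltonians generate the Lie algebra `𝔲(V)`
    (Function.Bijective (hamiltonianElement ħ : Observable V → UnitaryLie V) ∧
      ∀ H K : Observable V, ⁅hamiltonianElement ħ H, hamiltonianElement ħ K⁆ =
        hamiltonianElement ħ (heisenbergRHS ħ H K)) ∧
    -- the Poisson structure on `𝔲(V)*`
    (IsPoissonBracket 𝓘(ℝ, UnitaryDual V) (liePoisson (V := V)) ∧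
      ∀ H A : Observable V, ħ⁻¹ • liePoisson (observableHat H) (observableHat A) =
        observableHat (heisenbergRHS ħ H A)) ∧
    -- the Lie algebroid over `𝔲(V)*` whose anchor is the Heisenberg equation
    ((∃! ρ, IsHeisenbergAnchor 𝓘(ℝ, UnitaryDual V) ħ (id : UnitaryDual V → UnitaryDual V) ρ) ∧
      ∀ ρ, IsHeisenbergAnchor 𝓘(ℝ, UnitaryDual V) ħ (id : UnitaryDual V → UnitaryDual V) ρ →
        IsLieAlgebroid 𝓘(ℝ, UnitaryDual V) (UnitaryLie V)
          (Trivial (UnitaryDual V) (UnitaryLie V)) (sectionBracket 𝓘(ℝ, UnitaryDual V) ρ) ρ ∧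
        ∀ (H : Observable V) (f : UnitaryDual V → ℝ),
          ContMDiff 𝓘(ℝ, UnitaryDual V) 𝓘(ℝ, ℝ) ∞ f → ∀ ζ : UnitaryDual V,
            derivAlong 𝓘(ℝ, UnitaryDual V) f ζ (ρ ζ (hamiltonianElement ħ H)) =
              ħ⁻¹ * liePoisson (observableHat H) f ζ) ∧
    -- the Lie algebroid over the quantum phase space whose anchor is the Heisenberg equation
    ((∃! ρ, IsHeisenbergAnchor 𝓘(ℝ, EuclideanSpace ℂ (Fin n)) ħ
        (momentumMap : ℙ ℂ V → UnitaryDual V) ρ) ∧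
      ∀ ρ, IsHeisenbergAnchor 𝓘(ℝ, EuclideanSpace ℂ (Fin n)) ħ
          (momentumMap : ℙ ℂ V → UnitaryDual V) ρ →
        IsLieAlgebroid 𝓘(ℝ, EuclideanSpace ℂ (Fin n)) (UnitaryLie V)
          (Trivial (ℙ ℂ V) (UnitaryLie V))
          (sectionBracket 𝓘(ℝ, EuclideanSpace ℂ (Fin n)) ρ) ρ) := by
  exact ⟨⟨isPrincipalBundle_sphereProj, sphereProj_eq_mk_iff⟩,
    ⟨contMDiff_momentumMap, injective_momentumMap n, range_momentumMap⟩,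
    ⟨hamiltonianElement_bijective hħ.ne', lie_hamiltonianElement ħ⟩,
    ⟨isPoissonBracket_liePoisson, liePoisson_observableHat ħ⟩,
    ⟨existsUnique_isHeisenbergAnchor_id hħ.ne', fun ρ hρ =>
      ⟨isLieAlgebroid_dual hħ.ne' hρ, fun H f _ ζ => derivAlong_eq_liePoisson hħ.ne' hρ H f ζ⟩⟩,
    ⟨existsUnique_isHeisenbergAnchor_momentumMap hħ.ne',
      fun ρ hρ => isLieAlgebroid_projectivization hħ.ne' hρ⟩⟩
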